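/- Let $G$ be a compact connected Lie group with Lie algebra $g$. Let $I(G)$ be the ring of $\mathrm{Ad}(G)$-invariant complex-valued polynomials on $g$, let $I(G)^1=\{f\in I(G): f(0)=0\}$, let $\hat I(G)$ be the $I(G)^1$-adic completion of $I(G)$, and $\tilde I(G)=\hat I(G)/\mathbf{C}1$. A smooth homomorphism $f:H\to G$ induces, by composing polynomials with the differential $f_*:h\to g$, a map $\tilde f:\tilde I(G)\to\tilde I(H)$; for the inclusion of a closed subgroup it is denoted $\mathrm{res}^G_H$. Let $S(G)$ be the full subcategory of the orbit category of $G$ on the objects $G/H$ with $H\subseteq G$ a closed subgroup isomorphic to $S^1$, and let $V(G)=\lim_{S(G)}\tilde I(H)$ be the space of families $(x_H)_H$, $x_H\in\tilde I(H)$, such that $\tilde\alpha(x_K)=x_H$ whenever $a\in G$, $a^{-1}Ha\subseteq K$ and $\alpha:H\to K$ is $h\mapsto a^{-1}ha$. (1) The restriction map $R_G:\tilde I(G)\to V(G)$, $x\mapsto(\mathrm{res}^G_H x)_{H}$, is injective. (2) For a closed manifold $M$ with a smooth action of $G$ and a $G$-invariant Riemannian metric, let $T(M)\in\tilde I(G)$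 be the equivariant higher analytic torsion, represented by $$-\frac{d}{ds}\Big|_{s=0}\frac1{\Gamma(s)}\int_0^\infty\big(\mathrm{Tr}_s\,N e^{D_t^2}-\chi'(M)\big)\,t^{s-1}\,dt .$$ Here, for $X\in g$ with fundamental vector field $X^*$ on $M$, $D_t(X)=\sqrt t\,(d^*-d)+\frac1{4\sqrt t}\,(e_{X^*}+i_{X^*})$ on $\Omega(M)\otimes\mathbf{C}$, with $i_{X^*}$ interior multiplication and $d^*$, $e_{X^*}$ the $L^2$-adjoints of $d$, $i_{X^*}$; $N$ is the form degree, $\mathrm{Tr}_s$ the supertrace, $\chi'(M)=\sum_p p(-1)^p\dim H^p(M,\mathbf{R})$, and $e^{D_t^2}$ is a formal power series in $X$ with operator coefficients. The integral is understood, in each polynomial degree, as the sum of the meromorphic continuations in $s$ of $\int_0^1$ (from $\mathrm{Re}\,s\gg0$) and $\int_1^\infty$ (from $\mathrm{Re}\,s\ll0$). Then $T(M)$ is uniquely determined by the torsions $T(\mathrm{res}^G_H M)\in\tilde I(H)$ of $M$ as an $H$-manifold, for all closed subgroups $H\cong S^1$ of $G$: if $M,M'$ are closed $G$-manifolds with $G$-invariant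 metrics and $T(\mathrm{res}^G_H M)=T(\mathrm{res}^G_H M')$ for all such $H$ (computed with the given metrics), then $T(M)=T(M')$. -/

import Mathlib

open scoped Manifold ContDiff

section Polynomials

/-- The ring of complex-valued polynomial functions on the real vector space `V`:
the subalgebra generated by the real linear forms. -/
def PolyFun (V : Type*) [AddCommGroup V] [Module ℝ V] : Subalgebra ℂ (V → ℂ) :=
  Algebra.adjoin ℂ {f | ∃ l : V →ₗ[ℝ] ℝ, f = fun v => ((l v : ℝ) : ℂ)}

theorem PolyFun.comp_mem {V W : Type*} [AddCommGroup V] [Module ℝ V] [AddCommGroup W]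
    [Module ℝ W] (L : W →ₗ[ℝ] V) {f : V → ℂ} (hf : f ∈ PolyFun V) :
    (fun w => f (L w)) ∈ PolyFun W := by
  induction hf using Algebra.adjoin_induction with
  | mem x hx =>
    obtain ⟨l, rfl⟩ := hx
    exact Algebra.subset_adjoin ⟨l.comp L, rfl⟩
  | algebraMap r => exact (PolyFun W).algebraMap_mem r
  | add x y _ _ hx hy => exact (PolyFun W).add_mem hx hy
  | mul x y _ _ hx hy => exact (PolyFun W).mul_mem hx hy

end Polynomials

section LieGroups

variable (l m : ℕ)
variable (H : Type*) [TopologicalSpace H] [ChartedSpace (EuclideanSpace ℝ (Fin l)) H] [Group H]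
variable (G : Type*) [TopologicalSpace G] [ChartedSpace (EuclideanSpace ℝ (Fin m)) G] [Group G]

/-- The Lie algebra of the `m`-dimensional Lie group `G` (only its vector space structure
matters here). -/
abbrev LieAlg : Type := GroupLieAlgebra (𝓡 m) G

/-- Smooth homomorphisms of Lie groups. -/
abbrev LieGroupHom : Type _ := ContMDiffMonoidMorphism (𝓡 l) (𝓡 m) ∞ H G

variable {H G}

/-- The adjoint action: `Ad a` is the differential at `1` of `x ↦ a x a⁻¹`. -/
noncomputable def Ad (a : G) : LieAlg m G →L[ℝ] LieAlg m G :=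
  (mfderiv (𝓡 m) (𝓡 m) (fun x : G => a * x * a⁻¹) 1 :
    EuclideanSpace ℝ (Fin m) →L[ℝ] EuclideanSpace ℝ (Fin m))

variable {l m}

/-- The differential `f_* : h → g` at `1` of a homomorphism `f : H → G`. -/
noncomputable def lieMap (f : LieGroupHom l m H G) : LieAlg l H →L[ℝ] LieAlg m G :=
  (mfderiv (𝓡 l) (𝓡 m) f 1 : EuclideanSpace ℝ (Fin l) →L[ℝ] EuclideanSpace ℝ (Fin m))

variable (m G)

/-- `I(G)`: the ring of `Ad(G)`-invariant polynomials on the Lie algebra of `G`. -/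
noncomputable def InvPoly : Subalgebra ℂ (LieAlg m G → ℂ) where
  carrier := {f | f ∈ PolyFun (LieAlg m G) ∧ ∀ (a : G) (X : LieAlg m G), f (Ad m a X) = f X}
  mul_mem' := fun ha hb => ⟨mul_mem ha.1 hb.1, fun a X => by
    simp only [Pi.mul_apply, ha.2, hb.2]⟩
  add_mem' := fun ha hb => ⟨add_mem ha.1 hb.1, fun a X => by
    simp only [Pi.add_apply, ha.2, hb.2]⟩
  algebraMap_mem' := fun r => ⟨Subalgebra.algebraMap_mem _ r, fun _ _ => rfl⟩

/-- `I(G)¹ = {f ∈ I(G) | f(0) = 0}`. -/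
noncomputable def augIdeal : Ideal (InvPoly m G) :=
  RingHom.ker ((Pi.evalAlgHom ℂ (fun _ : LieAlg m G => ℂ) 0).comp (InvPoly m G).val)

/-- `Î(G)`: the `I(G)¹`-adic completion of `I(G)`. -/
abbrev CompletedInv : Type := AdicCompletion (augIdeal m G) (InvPoly m G)

/-- `Ĩ(G) = Î(G) / ℂ·1`. -/
abbrev ReducedInv : Type := CompletedInv m G ⧸ Submodule.span ℂ {(1 : CompletedInv m G)}

variable {m G}

theorem mdifferentiable_conj [LieGroup (𝓡 m) ∞ G] (a : G) :
    MDifferentiable (𝓡 m) (𝓡 m) (fun x : G => a * x * a⁻¹) := by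
  have h : ContMDiff (𝓡 m) (𝓡 m) ∞ (fun x : G => a * x * a⁻¹) :=
    (contMDiff_const.mul contMDiff_id).mul contMDiff_const
  exact h.mdifferentiable (by simp)

theorem lieMap_Ad [LieGroup (𝓡 l) ∞ H] [LieGroup (𝓡 m) ∞ G]
    (f : LieGroupHom l m H G) (a : H) (X : LieAlg l H) :
    lieMap f (Ad l a X) = Ad m (f a) (lieMap f X) := by
  have hf : MDifferentiable (𝓡 l) (𝓡 m) f :=
    f.contMDiff_toFun.mdifferentiable (by simp)
  have hH : MDifferentiable (𝓡 l) (𝓡 l) (fun x : H => a * x * a⁻¹) :=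
    mdifferentiable_conj a
  have hG : MDifferentiable (𝓡 m) (𝓡 m) (fun x : G => f a * x * (f a)⁻¹) :=
    mdifferentiable_conj (f a)
  have h1 := mfderiv_comp (I := 𝓡 l) (I' := 𝓡 l) (I'' := 𝓡 m) (1 : H) (g := f)
    (f := fun x : H => a * x * a⁻¹) (hf _) (hH _)
  have h2 := mfderiv_comp (I := 𝓡 l) (I' := 𝓡 m) (I'' := 𝓡 m) (1 : H)
    (g := fun x : G => f a * x * (f a)⁻¹) (f := f) (hG _) (hf _)
  have he : (f : H → G) ∘ (fun x : H => a * x * a⁻¹) =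
      (fun x : G => f a * x * (f a)⁻¹) ∘ (f : H → G) := by
    funext x
    simp
  rw [he] at h1
  have h3 := h1.symm.trans h2
  have e1 : a * 1 * a⁻¹ = 1 := by simp
  rw [e1, map_one] at h3
  exact congrArg (fun L : EuclideanSpace ℝ (Fin l) →L[ℝ] EuclideanSpace ℝ (Fin m) => L X) h3

variable [LieGroup (𝓡 l) ∞ H] [LieGroup (𝓡 m) ∞ G]

/-- The homomorphism `I(G) → I(H)` induced by `f : H → G`, i.e. composition with `f_*`. -/
noncomputable def invPolyMap (f : LieGroupHom l m H G) : InvPoly m G →ₐ[ℂ] InvPoly l H where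
  toFun p := ⟨fun X => p.1 (lieMap f X),
    PolyFun.comp_mem (lieMap f).toLinearMap p.2.1,
    fun a X => by
      change p.1 (lieMap f (Ad l a X)) = p.1 (lieMap f X)
      rw [lieMap_Ad, p.2.2]⟩
  map_one' := rfl
  map_mul' _ _ := rfl
  map_zero' := rfl
  map_add' _ _ := rfl
  commutes' _ := rfl

theorem augIdeal_pow_le_comap (f : LieGroupHom l m H G) (n : ℕ) :
    augIdeal m G ^ n ≤ (augIdeal l H ^ n).comap (invPolyMap f) := by
  refine le_trans ?_ (Ideal.le_comap_pow (invPolyMap f) n)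
  refine Ideal.pow_right_mono (fun p hp => ?_) n
  have hp' : p.1 0 = 0 := hp
  change p.1 (lieMap f 0) = 0
  rw [map_zero, hp']

theorem completedMap_compat (f : LieGroupHom l m H G) {a b : ℕ} (hab : a ≤ b) :
    (Ideal.Quotient.factorₐ ℂ (Ideal.pow_le_pow_right hab)).comp
      ((Ideal.quotientMapₐ (augIdeal l H ^ b) (invPolyMap f) (augIdeal_pow_le_comap f b)).comp
        ((AdicCompletion.evalₐ (augIdeal m G) b).restrictScalars ℂ)) =
      (Ideal.quotientMapₐ (augIdeal l H ^ a) (invPolyMap f) (augIdeal_pow_le_comap f a)).comp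
        ((AdicCompletion.evalₐ (augIdeal m G) a).restrictScalars ℂ) := by
  ext x
  induction x using AdicCompletion.induction_on with | h s => ?_
  simpa [AdicCompletion.evalₐ_mk] using
    congrArg (Ideal.quotientMapₐ (augIdeal l H ^ a) (invPolyMap f)
      (augIdeal_pow_le_comap f a)) (AdicCompletion.Ideal.mk_eq_mk _ hab s)

/-- The homomorphism `Î(G) → Î(H)` induced by `f : H → G` on completions. -/
noncomputable def completedMap (f : LieGroupHom l m H G) :
    CompletedInv m G →ₐ[ℂ] CompletedInv l H :=
  AdicCompletion.liftAlgHom (augIdeal l H)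
    (fun n => (Ideal.quotientMapₐ (augIdeal l H ^ n) (invPolyMap f)
      (augIdeal_pow_le_comap f n)).comp
        ((AdicCompletion.evalₐ (augIdeal m G) n).restrictScalars ℂ))
    (fun hab => completedMap_compat f hab)

theorem completedMap_eval (f : LieGroupHom l m H G) (n : ℕ) (x : CompletedInv m G)
    (p : InvPoly m G) (hp : AdicCompletion.evalₐ (augIdeal m G) n x = Ideal.Quotient.mk _ p) :
    AdicCompletion.evalₐ (augIdeal l H) n (completedMap f x) =
      Ideal.Quotient.mk _ (invPolyMap f p) := by
  rw [completedMap, AdicCompletion.evalₐ_liftAlgHom _ _ (fun hab => completedMap_compat f hab)]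
  simp [hp]

/-- The homomorphism `f̃ : Ĩ(G) → Ĩ(H)` induced by `f : H → G`. -/
noncomputable def reducedMap (f : LieGroupHom l m H G) : ReducedInv m G →ₗ[ℂ] ReducedInv l H :=
  Submodule.mapQ _ _ (completedMap f).toLinearMap (by
    rw [Submodule.span_le, Set.singleton_subset_iff]
    simp)

end LieGroups

section CircleSubgroups

variable (m : ℕ) (G : Type*) [TopologicalSpace G] [ChartedSpace (EuclideanSpace ℝ (Fin m)) G]
  [Group G]

/-- A closed subgroup `H ⊆ G` isomorphic to `S¹`, together with an isomorphism `S¹ ≅ H`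
through which `Ĩ(H)` is identified with `Ĩ(S¹)` (every `H ≅ S¹` occurs, with all its
identifications): an injective smooth homomorphism `S¹ → G`
(its image `H` is compact, hence closed). -/
structure CircleSubgroup where
  incl : LieGroupHom 1 m Circle G
  injective : Function.Injective incl

variable {m G}

/-- `IsOrbitMorphism H K a α`: the map `xH ↦ xaK` is a (well-defined) `G`-map `G/H → G/K`, i.e.
`a⁻¹ H a ⊆ K`, and `α : S¹ → S¹` is the homomorphism `H → K`, `h ↦ a⁻¹ h a`. -/
def IsOrbitMorphism (H K : CircleSubgroup m G) (a : G) (α : LieGroupHom 1 1 Circle Circle) : Prop :=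
  ∀ z : Circle, K.incl (α z) = a⁻¹ * H.incl z * a

variable (m G)

/-- `V(G) = lim_{S(G)} Ĩ_G`: the space of sections of the contravariant functor `G/H ↦ Ĩ(H)` on
the full subcategory `S(G)` of the orbit category with objects `G/H`, `H ≅ S¹`. -/
def CircleLimit : Submodule ℂ (CircleSubgroup m G → ReducedInv 1 Circle) where
  carrier := {x | ∀ (H K : CircleSubgroup m G) (a : G) (α : LieGroupHom 1 1 Circle Circle),
    IsOrbitMorphism H K a α → reducedMap α (x K) = x H}
  add_mem' := fun hx hy H K a α h => by simp [hx H K a α h, hy H K a α h]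
  zero_mem' := fun H K a α h => by simp
  smul_mem' := fun c x hx H K a α h => by simp [hx H K a α h]

variable [LieGroup (𝓡 m) ∞ G]

theorem invPolyMap_orbitMorphism {H K : CircleSubgroup m G} {a : G}
    {α : LieGroupHom 1 1 Circle Circle} (h : IsOrbitMorphism H K a α) (p : InvPoly m G) :
    invPolyMap α (invPolyMap K.incl p) = invPolyMap H.incl p := by
  apply Subtype.ext
  funext X
  change p.1 (lieMap K.incl (lieMap α X)) = p.1 (lieMap H.incl X)
  have hα : MDifferentiable (𝓡 1) (𝓡 1) α := α.contMDiff_toFun.mdifferentiable (by simp)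
  have hK : MDifferentiable (𝓡 1) (𝓡 m) K.incl :=
    K.incl.contMDiff_toFun.mdifferentiable (by simp)
  have hH : MDifferentiable (𝓡 1) (𝓡 m) H.incl :=
    H.incl.contMDiff_toFun.mdifferentiable (by simp)
  have h1 := mfderiv_comp (I := 𝓡 1) (I' := 𝓡 1) (I'' := 𝓡 m) (1 : Circle) (g := K.incl)
    (f := α) (hK _) (hα _)
  have h2 := mfderiv_comp (I := 𝓡 1) (I' := 𝓡 m) (I'' := 𝓡 m) (1 : Circle)
    (g := fun x : G => a⁻¹ * x * a⁻¹⁻¹) (f := H.incl) (mdifferentiable_conj a⁻¹ _) (hH _)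
  have he : (K.incl : Circle → G) ∘ (α : Circle → Circle) =
      (fun x : G => a⁻¹ * x * a⁻¹⁻¹) ∘ (H.incl : Circle → G) := by
    funext z
    simpa using h z
  rw [he] at h1
  have h3 := h1.symm.trans h2
  rw [map_one α, map_one H.incl] at h3
  have h4 : lieMap K.incl (lieMap α X) = Ad m a⁻¹ (lieMap H.incl X) :=
    congrArg (fun L : EuclideanSpace ℝ (Fin 1) →L[ℝ] EuclideanSpace ℝ (Fin m) => L X) h3
  rw [h4, p.2.2]

theorem res_mem_circleLimit (x : ReducedInv m G) :
    (fun H : CircleSubgroup m G => reducedMap H.incl x) ∈ CircleLimit m G := by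
  intro H K a α h
  obtain ⟨y, rfl⟩ := Submodule.Quotient.mk_surjective _ x
  change Submodule.Quotient.mk (completedMap α (completedMap K.incl y)) =
    Submodule.Quotient.mk (completedMap H.incl y)
  congr 1
  apply AdicCompletion.ext_evalₐ
  intro n
  obtain ⟨p, hp⟩ := Ideal.Quotient.mk_surjective (AdicCompletion.evalₐ (augIdeal m G) n y)
  rw [completedMap_eval α n _ _ (completedMap_eval K.incl n y p hp.symm),
    completedMap_eval H.incl n y p hp.symm, invPolyMap_orbitMorphism m G h]

/-- The restriction map `R_G : Ĩ(G) → V(G)`, `x ↦ (res^G_H x)_H`. -/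
noncomputable def circleRestriction : ReducedInv m G →ₗ[ℂ] CircleLimit m G :=
  LinearMap.codRestrict (CircleLimit m G)
    { toFun := fun x H => reducedMap H.incl x
      map_add' := fun x y => by funext H; exact map_add _ x y
      map_smul' := fun c x => by funext H; exact map_smul _ c x }
    (res_mem_circleLimit m G)

end CircleSubgroups

section Forms

open MeasureTheory Filter Topology Set

/-- The model space of `n`-dimensional manifolds. -/
abbrev Mdl (n : ℕ) : Type := EuclideanSpace ℝ (Fin n)

variable {n : ℕ} {M : Type*} [TopologicalSpace M] [ChartedSpace (EuclideanSpace ℝ (Fin n)) M]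

variable (n M) in
/-- (Not necessarily continuous) complex-valued differential forms of mixed degree on `M`;
`ξ p x` is the component of degree `p` at the point `x`. -/
abbrev MixedForm : Type _ :=
  ∀ (p : ℕ) (x : M), TangentSpace (𝓡 n) x [⋀^Fin p]→L[ℝ] ℂ

/-- The `p`-form `ξ` in the chart at `x₀`: its pullback by the inverse chart. -/
noncomputable def chartForm {p : ℕ} (ξ : ∀ x : M, TangentSpace (𝓡 n) x [⋀^Fin p]→L[ℝ] ℂ)
    (x₀ : M) (y : Mdl n) : Mdl n [⋀^Fin p]→L[ℝ] ℂ :=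
  (ξ ((extChartAt (𝓡 n) x₀).symm y)).compContinuousLinearMap
    (mfderiv 𝓘(ℝ, Mdl n) (𝓡 n) (extChartAt (𝓡 n) x₀).symm y)

/-- `ξ ∈ Ω(M)`: all components of `ξ` are smooth in all charts. -/
def IsSmoothForm (ξ : MixedForm n M) : Prop :=
  ∀ (p : ℕ) (x₀ : M), ContDiffOn ℝ ∞ (chartForm (ξ p) x₀) (extChartAt (𝓡 n) x₀).target

/-- The de Rham differential, computed at `x` in the chart at `x`. -/
noncomputable def deRham (ξ : MixedForm n M) : MixedForm n M
  | 0, _ => 0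
  | p + 1, x => (extDeriv (chartForm (ξ p) x) (extChartAt (𝓡 n) x x)).compContinuousLinearMap
      (mfderiv (𝓡 n) 𝓘(ℝ, Mdl n) (extChartAt (𝓡 n) x) x)

/-- Interior multiplication `i_V` by the vector field `V`. -/
noncomputable def interiorMul (V : ∀ x : M, TangentSpace (𝓡 n) x) (ξ : MixedForm n M) :
    MixedForm n M :=
  fun p x => ContinuousAlternatingMap.curryLeft (𝕜 := ℝ) (E := Mdl n) (F := ℂ)
    (ξ (p + 1) x) (V x)

variable (n M) in
/-- Smooth Riemannian metrics on `M`. -/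
abbrev SmoothMetric [IsManifold (𝓡 n) ∞ M] : Type _ :=
  Bundle.ContMDiffRiemannianMetric (𝓡 n) ∞ (Mdl n) (fun x : M => TangentSpace (𝓡 n) x)

variable [IsManifold (𝓡 n) ∞ M] (g : SmoothMetric n M)

/-- The Riemannian volume measure: on the domain of each chart it is
`√(det (g_ij)) dy₁ ⋯ dyₙ`, and it is the supremum of these measures. -/
noncomputable def riemVolume : @Measure M (borel M) :=
  letI : MeasurableSpace M := borel M
  ⨆ x₀ : M, Measure.map (extChartAt (𝓡 n) x₀).symm
    (((volume : Measure (Mdl n)).restrict (extChartAt (𝓡 n) x₀).target).withDensity fun y =>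
      ENNReal.ofReal (Real.sqrt (Matrix.det (Matrix.of fun i j : Fin n =>
        g.inner ((extChartAt (𝓡 n) x₀).symm y)
          (mfderiv 𝓘(ℝ, Mdl n) (𝓡 n) (extChartAt (𝓡 n) x₀).symm y
            (EuclideanSpace.single i (1 : ℝ) : Mdl n))
          (mfderiv 𝓘(ℝ, Mdl n) (𝓡 n) (extChartAt (𝓡 n) x₀).symm y
            (EuclideanSpace.single j (1 : ℝ) : Mdl n))))))

/-- An orthonormal frame of `T_x M`. -/
noncomputable def orthoFrame (x : M) : Fin n → TangentSpace (𝓡 n) x :=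
  Classical.epsilon fun b => ∀ i j, g.inner x (b i) (b j) = if i = j then 1 else 0

/-- The Hermitian inner product of two alternating `p`-forms at `x`; summing over all (instead of
increasing) multi-indices is compensated by the factor `1 / p!`. -/
noncomputable def pointInner (p : ℕ) (x : M) (α β : TangentSpace (𝓡 n) x [⋀^Fin p]→L[ℝ] ℂ) : ℂ :=
  (1 / (p.factorial : ℂ)) * ∑ c : Fin p → Fin n,
    starRingEnd ℂ (α fun i => orthoFrame g x (c i)) * β fun i => orthoFrame g x (c i)

/-- The `L²` inner product on `Ω(M)`; different degrees are orthogonal. -/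
noncomputable def l2Inner (ξ ζ : MixedForm n M) : ℂ :=
  letI : MeasurableSpace M := borel M
  ∑ p ∈ Finset.range (n + 1), ∫ x, pointInner g p x (ξ p x) (ζ p x) ∂(riemVolume g)

open Classical in
/-- The `L²`-adjoint of an operator `A` on `Ω(M)`: the unique smooth `η = A^* ξ` with
`⟨A β, ξ⟩ = ⟨β, η⟩` for all smooth `β`. (It exists for `d` and for `i_V`, `V` smooth.) -/
noncomputable def formAdjoint (A : MixedForm n M → MixedForm n M) (ξ : MixedForm n M) :
    MixedForm n M :=
  if h : ∃ η, IsSmoothForm η ∧ ∀ β, IsSmoothForm β → l2Inner g (A β) ξ = l2Inner g β η then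
    h.choose else 0

end Forms

section Heat

open MeasureTheory Filter Topology Set

variable {n : ℕ} {M : Type*} [TopologicalSpace M] [ChartedSpace (EuclideanSpace ℝ (Fin n)) M]

variable (n M) in
/-- Formal power series `∑ rᵏ u k` with coefficients in the mixed forms. The variable `r` records
the restriction of polynomials on `g` to a line `r ↦ r X`. -/
abbrev FormSeries : Type _ := ℕ → MixedForm n M

/-- Application of `r ⊗ A` to a formal power series. -/
noncomputable def shiftApply (A : MixedForm n M → MixedForm n M) (u : FormSeries n M) : FormSeries n M
  | 0 => 0
  | k + 1 => A (u k)

variable [IsManifold (𝓡 n) ∞ M] (g : SmoothMetric n M) (V : ∀ x : M, TangentSpace (𝓡 n) x)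

/-- `d_t = √t d - (1 / (4 √t)) r i_V`. -/
noncomputable def dT (t : ℝ) (u : FormSeries n M) : FormSeries n M := fun k =>
  Real.sqrt t • deRham (u k) - (1 / (4 * Real.sqrt t)) • shiftApply (interiorMul V) u k

/-- `δ_t = √t d* + (1 / (4 √t)) r e_V`, with `d*` and `e_V` the adjoints of `d` and `i_V`. -/
noncomputable def deltaT (t : ℝ) (u : FormSeries n M) : FormSeries n M := fun k =>
  Real.sqrt t • formAdjoint g deRham (u k)
    + (1 / (4 * Real.sqrt t)) • shiftApply (formAdjoint g (interiorMul V)) u k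

/-- `D_t = δ_t - d_t`. -/
noncomputable def diracT (t : ℝ) (u : FormSeries n M) : FormSeries n M :=
  deltaT g V t u - dT V t u

/-- `u s`, `s ≥ 0`, solves the heat equation `∂_s u = D_t² u` in `Ω(M)[[r]]`, the derivative
being taken coefficientwise in `L²` (one-sided at `s = 0`). -/
def IsHeatFlow (t : ℝ) (u : ℝ → FormSeries n M) : Prop :=
  ∀ k : ℕ, ∀ s : ℝ, 0 ≤ s → IsSmoothForm (u s k) ∧
    Tendsto (fun h : ℝ =>
        (l2Inner g (h⁻¹ • (u (s + h) k - u s k) - diracT g V t (diracT g V t (u s)) k)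
          (h⁻¹ • (u (s + h) k - u s k) - diracT g V t (diracT g V t (u s)) k)).re)
      (𝓝[{h | h ≠ 0 ∧ 0 ≤ s + h}] 0) (𝓝 0)

/-- `β` is the image of `α ∈ Ω(M)` under the coefficient of `rᵏ` in `exp (D_t²)`. -/
def IsHeatCoeff (t : ℝ) (k : ℕ) (α β : MixedForm n M) : Prop :=
  ∃ u : ℝ → FormSeries n M, IsHeatFlow g V t u ∧ u 0 0 = α ∧ (∀ j, 0 < j → u 0 j = 0) ∧ u 1 k = β

/-- `S` is an `L²`-orthonormal basis of the `p`-forms consisting of smooth forms. -/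
def IsL2Basis (p : ℕ) (S : Set (MixedForm n M)) : Prop :=
  (∀ e ∈ S, IsSmoothForm e ∧ ∀ q, q ≠ p → e q = 0) ∧
  (∀ e ∈ S, ∀ f ∈ S, (e = f → l2Inner g e f = 1) ∧ (e ≠ f → l2Inner g e f = 0)) ∧
  ∀ α, IsSmoothForm α → (∀ q, q ≠ p → α q = 0) → ∀ ε : ℝ, 0 < ε →
    ∃ β ∈ Submodule.span ℂ S, (l2Inner g (α - β) (α - β)).re < ε

/-- `z` is the trace of the `rᵏ`-coefficient of `exp (D_t²)`, compressed to the `p`-forms. -/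
def IsHeatTrace (t : ℝ) (k p : ℕ) (z : ℂ) : Prop :=
  ∃ U : MixedForm n M → MixedForm n M, (∀ α, IsSmoothForm α → IsHeatCoeff g V t k α (U α)) ∧
    ∀ S : Set (MixedForm n M), IsL2Basis g p S →
      HasSum (fun e : S => l2Inner g (e : MixedForm n M) (U e)) z

/-- `z` is the `rᵏ`-coefficient of the supertrace `Tr_s N exp (D_t²)`, where `N` is the degree. -/
def IsHeatSupertrace (t : ℝ) (k : ℕ) (z : ℂ) : Prop :=
  ∃ w : ℕ → ℂ, (∀ p ≤ n, IsHeatTrace g V t k p (w p)) ∧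
    z = ∑ p ∈ Finset.range (n + 1), (-1) ^ p * (p : ℂ) * w p

/-- For `k ≥ 1`, `c` is the coefficient of `rᵏ` in
`- d/ds|_{s = 0} (1 / Γ(s)) ∫₀^∞ (Tr_s N exp (D_t²) - χ'(M)) t^(s - 1) dt`
(the constant `χ'(M)` contributes to `k = 0` only). The integral is understood as usual for Mellin
transforms, as the sum of the meromorphic continuations of `∫₀¹`, which converges for
`Re s ≫ 0`, and of `∫₁^∞`, which converges for `Re s ≪ 0`. -/
def IsTorsionCoeff (k : ℕ) (c : ℂ) : Prop :=
  ∃ (θ : ℝ → ℂ) (Z₀ Z₁ F : ℂ → ℂ),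
    (∀ t, 0 < t → IsHeatSupertrace g V t k (θ t)) ∧
    MeromorphicOn Z₀ univ ∧ MeromorphicOn Z₁ univ ∧
    (∃ a : ℝ, ∀ s : ℂ, a < s.re →
      IntegrableOn (fun t : ℝ => θ t * (t : ℂ) ^ (s - 1)) (Ioc 0 1) ∧
      Z₀ s = ∫ t in Ioc (0 : ℝ) 1, θ t * (t : ℂ) ^ (s - 1)) ∧
    (∃ b : ℝ, ∀ s : ℂ, s.re < b →
      IntegrableOn (fun t : ℝ => θ t * (t : ℂ) ^ (s - 1)) (Ioi 1) ∧
      Z₁ s = ∫ t in Ioi (1 : ℝ), θ t * (t : ℂ) ^ (s - 1)) ∧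
    AnalyticAt ℂ F 0 ∧
    (∀ᶠ s in 𝓝[≠] (0 : ℂ), F s = -((Complex.Gamma s)⁻¹ * (Z₀ s + Z₁ s))) ∧
    c = deriv F 0

end Heat

section Torsion

/-- A smooth action of the Lie group `G` on the manifold `M`. -/
structure SmoothAction (m n : ℕ) (G M : Type*)
    [TopologicalSpace G] [ChartedSpace (EuclideanSpace ℝ (Fin m)) G] [Group G]
    [TopologicalSpace M] [ChartedSpace (EuclideanSpace ℝ (Fin n)) M] where
  act : G →* Equiv.Perm M
  smooth : ContMDiff ((𝓡 m).prod (𝓡 n)) (𝓡 n) ∞ (fun q : G × M => act q.1 q.2)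

variable {l m n : ℕ} {H G M : Type*}
  [TopologicalSpace H] [ChartedSpace (EuclideanSpace ℝ (Fin l)) H] [Group H]
  [TopologicalSpace G] [ChartedSpace (EuclideanSpace ℝ (Fin m)) G] [Group G]
  [TopologicalSpace M] [ChartedSpace (EuclideanSpace ℝ (Fin n)) M]

/-- `f^* M`: the manifold `M` with the action of `H` induced by a homomorphism `f : H → G`. For an
inclusion this is `res^G_H M`. -/
def SmoothAction.pullback (ρ : SmoothAction m n G M) (f : LieGroupHom l m H G) :
    SmoothAction l n H M where
  act := ρ.act.comp f.toMonoidHom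
  smooth := ρ.smooth.comp (f.contMDiff_toFun.prodMap contMDiff_id)

/-- The fundamental vector field `X^*` of `X ∈ g`, `X^*(x) = d/dt|_{t = 0} exp(t X) x`. -/
noncomputable def SmoothAction.fundamental (ρ : SmoothAction m n G M) (X : LieAlg m G) (x : M) :
    TangentSpace (𝓡 n) x :=
  (mfderiv (𝓡 m) (𝓡 n) (fun a : G => ρ.act a x) 1 :
    EuclideanSpace ℝ (Fin m) →L[ℝ] EuclideanSpace ℝ (Fin n)) X

variable [IsManifold (𝓡 n) ∞ M]

/-- The Riemannian metric `g` is `G`-invariant. -/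
def SmoothAction.IsInvariantMetric (ρ : SmoothAction m n G M) (g : SmoothMetric n M) : Prop :=
  ∀ (a : G) (x : M) (v w : TangentSpace (𝓡 n) x),
    g.inner (ρ.act a x) (mfderiv (𝓡 n) (𝓡 n) (ρ.act a) x v) (mfderiv (𝓡 n) (𝓡 n) (ρ.act a) x w)
      = g.inner x v w

/-- The value at `X` of the homogeneous part of degree `k` of the polynomial function `f`. -/
noncomputable def homogPart (f : LieAlg m G → ℂ) (k : ℕ) (X : LieAlg m G) : ℂ :=
  iteratedDeriv k (fun r : ℝ => f (r • X)) 0 / (k.factorial : ℂ)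

/-- `τ ∈ Ĩ(G)` is the equivariant higher torsion `T(M)` of the `G`-manifold `M`, computed with the
metric `g`: `τ` has a representative `x ∈ Î(G)` whose homogeneous part of each degree `k ≥ 1` takes
the value `c` at `X ∈ g`, where `c` is the degree `k` coefficient of the torsion along the line
`r ↦ r X`. (`x` modulo `(I(G)¹)^(k+1)` determines the part of degree `k`; the part of
degree `0` is killed in `Ĩ(G)`.) -/
def IsTorsion (ρ : SmoothAction m n G M) (g : SmoothMetric n M) (τ : ReducedInv m G) : Prop :=
  ∃ x : CompletedInv m G, Submodule.Quotient.mk x = τ ∧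
    ∀ (k : ℕ), 1 ≤ k → ∀ f : InvPoly m G,
      AdicCompletion.evalₐ (augIdeal m G) (k + 1) x = Ideal.Quotient.mk _ f →
        ∀ X : LieAlg m G, IsTorsionCoeff g (ρ.fundamental X) k (homogPart f.1 k X)

end Torsion

/-! Let x in Î(G) restrict to a constant on every circle subgroup. Elements of `augIdeal m G ^ n`
vanish to order n at 0, so for k ≥ 1 the class of x modulo the power k + 1 has a well-defined part
of degree k (`homogPart_congr_of_sub_mem`). It is a homogeneous invariant polynomial on g that
vanishes on the tangent line of every circle subgroup.

These lines are dense in g (`exists_periodic_near`, `exists_circleSubgroup`). By compactness,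
exp(tX) comes back close to 1 at arbitrarily large times t, so exp(tX) = exp(Z) with Z small.
Injectivity of exp near 0 forces Ad(exp(sX)) Z = Z for all s. Hence the subgroups of X and Z
commute, and Y = X - Z/t, which is close to X, satisfies exp(tY) = 1. If Y ≠ 0, its one-parameter
subgroup is a circle. By continuity, all parts of x of positive degree vanish. The facts about exp
come from an ODE with parameters in the chart at 1; no maximal torus enters.

It remains to compare degree with the adic filtration: x is constant modulo each power of the
augmentation ideal once invariants of large degree are known to lie in that power. This is Hilbert's
finiteness argument with averaging over Haar measure (`exists_homogeneous_mem_pow`).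

The statement on torsion is then formal. The torsion is prescribed through the fundamental fields
along lines r ↦ rX, and the field of X for the restricted action is that of f_* X, so torsion
commutes with restriction (`IsTorsion.pullback`). No property of the heat operators is needed. -/

/-! ### Ordinary differential equations depending linearly on a parameter. -/

section ParametricODE

open Set Metric Filter Topology NNReal

variable {E F : Type*} [NormedAddCommGroup E] [NormedSpace ℝ E] [CompleteSpace E]
  [NormedAddCommGroup F] [NormedSpace ℝ F]

/-- An autonomous Lipschitz ODE whose speed on the closed ball of radius `r` is at most `r / 2` has
a solution on `[-2, 2]` that starts at the centre and stays in the ball. -/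
theorem exists_integralCurve_mem_closedBall {f : E → E} {p : E} {r K : ℝ≥0}
    (hl : LipschitzOnWith K f (closedBall p r)) (hb : ∀ x ∈ closedBall p r, ‖f x‖ ≤ (r / 2 : ℝ≥0)) :
    ∃ c : ℝ → E, c 0 = p ∧ ∀ t ∈ Icc (-2 : ℝ) 2, c t ∈ closedBall p r ∧
      HasDerivWithinAt c (f (c t)) (Icc (-2 : ℝ) 2) t := by
  have h0 : (0 : ℝ) ∈ Icc (-2 : ℝ) 2 := by constructor <;> norm_num
  -- Speed `r / 2` over time 2 on either side of 0 covers exactly the radius `r`.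
  have hf : IsPicardLindelof (fun _ => f) (tmin := -2) (tmax := 2) ⟨0, h0⟩ p r 0 (r / 2) K := by
    refine IsPicardLindelof.of_time_independent hb hl ?_
    push_cast
    norm_num
  obtain ⟨α, hα⟩ := ODE.FunSpace.exists_isFixedPt_next hf (mem_closedBall_self le_rfl)
  refine ⟨α.compProj, ?_, fun t ht => ⟨α.compProj_mem_closedBall hf.mul_max_le, ?_⟩⟩
  · have : α.compProj ((⟨0, h0⟩ : Icc (-2 : ℝ) 2) : ℝ) = p := by
      rw [ODE.FunSpace.compProj_val, ← hα, ODE.FunSpace.next_apply₀]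
    exact this
  · apply ODE.hasDerivWithinAt_picard_Icc h0 hf.continuousOn_uncurry
      α.continuous_compProj.continuousOn (fun _ ht' ↦ α.compProj_mem_closedBall hf.mul_max_le)
      p ht |>.congr_of_mem _ ht
    intro t' ht'
    nth_rw 1 [← hα]
    rw [ODE.FunSpace.compProj_of_mem ht', ODE.FunSpace.next_apply]

/-- The solutions of `c' = A c X`, `c 0 = p`, exist on `[-2, 2]` for small parameters `X`, and their
value at time `1` is strictly differentiable in the parameter at `X = 0`, with derivative `A p`. -/
theorem exists_integralCurve_hasStrictFDerivAt {A : E → F →L[ℝ] E} {p : E}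
    (hA : ContDiffAt ℝ 1 A p) {U : Set E} (hU : U ∈ 𝓝 p) :
    ∃ δ > 0, ∃ c : F → ℝ → E,
      (∀ X, ‖X‖ < δ → c X 0 = p ∧ ∀ t ∈ Icc (-2 : ℝ) 2, c X t ∈ U ∧
        HasDerivWithinAt (c X) (A (c X t) X) (Icc (-2 : ℝ) 2) t) ∧
      HasStrictFDerivAt (fun X => c X 1) (A p) 0 := by
  obtain ⟨K, s, hs, hK⟩ := hA.exists_lipschitzOnWith
  obtain ⟨r', hr', hball⟩ := Metric.nhds_basis_closedBall.mem_iff.1 (inter_mem hs hU)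
  lift r' to ℝ≥0 using hr'.le
  rename ℝ≥0 => r
  have hr : (0 : ℝ) < r := hr'
  have hK' : LipschitzOnWith K A (closedBall p r) := hK.mono fun x hx => (hball hx).1
  set M : ℝ := ‖A p‖ + K * r + 1 with hM
  have hM0 : 0 < M := by positivity
  have hMb : ∀ x ∈ closedBall p r, ‖A x‖ ≤ M := by
    intro x hx
    have h1 := hK'.dist_le_mul x hx p (mem_closedBall_self hr.le)
    have h2 : ‖A x‖ ≤ ‖A p‖ + dist (A x) (A p) := by
      rw [dist_eq_norm]; exact norm_le_insert' _ _
    have h3 : (K : ℝ) * dist x p ≤ K * r := by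
      gcongr; exact hx
    linarith
  -- The first bound keeps the speed below `r / 2`; the second makes `x ↦ A x X` 1-Lipschitz on the
  -- ball, so that Grönwall constants do not depend on X.
  set δ : ℝ := min (r / (2 * M)) (1 / (K + 1)) with hδ
  have hδ0 : 0 < δ := lt_min (by positivity) (by positivity)
  have hex : ∀ X : F, ‖X‖ < δ → ∃ c : ℝ → E, c 0 = p ∧ ∀ t ∈ Icc (-2 : ℝ) 2,
      c t ∈ closedBall p r ∧ HasDerivWithinAt c (A (c t) X) (Icc (-2 : ℝ) 2) t := by
    intro X hX
    have h1 : M * ‖X‖ ≤ r / 2 := by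
      have := (hX.trans_le (min_le_left _ _)).le
      rw [le_div_iff₀ (by positivity)] at this
      linarith
    have hl : LipschitzOnWith (K * ‖X‖₊) (fun x => A x X) (closedBall p r) := by
      refine LipschitzOnWith.of_dist_le_mul fun x hx y hy => ?_
      rw [dist_eq_norm, ← sub_apply]
      refine (ContinuousLinearMap.le_opNorm _ _).trans ?_
      rw [← dist_eq_norm]
      have := hK'.dist_le_mul x hx y hy
      push_cast
      calc dist (A x) (A y) * ‖X‖ ≤ (K * dist x y) * ‖X‖ := by gcongr
        _ = _ := by ring
    refine exists_integralCurve_mem_closedBall hl fun x hx => ?_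
    refine ((A x).le_opNorm X).trans ?_
    push_cast
    calc ‖A x‖ * ‖X‖ ≤ M * ‖X‖ := by gcongr; exact hMb x hx
      _ ≤ _ := h1
  have hex' : ∃ c : F → ℝ → E, ∀ X : F, ‖X‖ < δ → c X 0 = p ∧ ∀ t ∈ Icc (-2 : ℝ) 2,
      c X t ∈ closedBall p r ∧ HasDerivWithinAt (c X) (A (c X t) X) (Icc (-2 : ℝ) 2) t := by
    classical
    choose! c hc using hex
    exact ⟨c, hc⟩
  obtain ⟨c, hc⟩ := hex'
  refine ⟨δ, hδ0, c, fun X hX => ⟨(hc X hX).1, fun t ht =>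
    ⟨(hball ((hc X hX).2 t ht).1).2, ((hc X hX).2 t ht).2⟩⟩, ?_⟩
  have hsub : Icc (0 : ℝ) 1 ⊆ Icc (-2 : ℝ) 2 := Icc_subset_Icc (by norm_num) (by norm_num)
  have hd : ∀ X, ‖X‖ < δ → ∀ t ∈ Icc (0 : ℝ) 1,
      HasDerivWithinAt (c X) (A (c X t) X) (Icc (0 : ℝ) 1) t := fun X hX t ht =>
    ((hc X hX).2 t (hsub ht)).2.mono hsub
  have hmem : ∀ X, ‖X‖ < δ → ∀ t ∈ Icc (0 : ℝ) 1, c X t ∈ closedBall p r := fun X hX t ht =>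
    ((hc X hX).2 t (hsub ht)).1
  have hIci : ∀ X, ‖X‖ < δ → ∀ t ∈ Ico (0 : ℝ) 1,
      HasDerivWithinAt (c X) (A (c X t) X) (Ici t) t := fun X hX t ht =>
    ((hd X hX t (Ico_subset_Icc_self ht)).mono_of_mem_nhdsWithin
      (Icc_mem_nhdsGE_of_mem ht))
  -- the solutions stay close to `p`
  have hclose : ∀ X, ‖X‖ < δ → ∀ t ∈ Icc (0 : ℝ) 1, ‖c X t - p‖ ≤ M * ‖X‖ := by
    intro X hX t ht
    have h := norm_image_sub_le_of_norm_deriv_le_segment' (C := M * ‖X‖) (hd X hX)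
      (fun u hu => ((A _).le_opNorm X).trans (by
        gcongr; exact hMb _ (hmem X hX u (Ico_subset_Icc_self hu)))) t ht
    rw [(hc X hX).1, sub_zero] at h
    refine h.trans (mul_le_of_le_one_right (by positivity) ht.2)
  -- and depend on `X` in a Lipschitz way
  have hlip : ∀ X Y, ‖X‖ < δ → ‖Y‖ < δ → ∀ t ∈ Icc (0 : ℝ) 1,
      ‖c X t - c Y t‖ ≤ 2 * M * ‖X - Y‖ := by
    intro X Y hX hY t ht
    have hKX : (K : ℝ) * ‖X‖ ≤ 1 := by
      have := (hX.trans_le (min_le_right _ _)).le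
      rw [le_div_iff₀ (by positivity)] at this
      nlinarith [norm_nonneg X]
    have hv : ∀ t ∈ Ico (0 : ℝ) 1, LipschitzOnWith 1 (fun x => A x X) (closedBall p r) := by
      intro _ _
      refine LipschitzOnWith.of_dist_le_mul fun x hx y hy => ?_
      rw [dist_eq_norm, ← sub_apply]
      refine (ContinuousLinearMap.le_opNorm _ _).trans ?_
      rw [← dist_eq_norm]
      have := hK'.dist_le_mul x hx y hy
      calc dist (A x) (A y) * ‖X‖ ≤ (K * dist x y) * ‖X‖ := by gcongr
        _ = (K * ‖X‖) * dist x y := by ring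
        _ ≤ _ := by push_cast; gcongr
    have h := dist_le_of_approx_trajectories_ODE_of_mem (v := fun _ x => A x X)
      (s := fun _ => closedBall p r) (εf := 0) (εg := M * ‖X - Y‖) (δ := 0) hv
      (fun t ht => (hd X hX t ht).continuousWithinAt) (hIci X hX) (fun t _ => by simp)
      (fun t ht => hmem X hX t (Ico_subset_Icc_self ht))
      (fun t ht => (hd Y hY t ht).continuousWithinAt) (hIci Y hY)
      (fun t ht => by
        rw [dist_comm, dist_eq_norm, ← map_sub]
        refine ((A _).le_opNorm _).trans ?_
        gcongr
        exact hMb _ (hmem Y hY t (Ico_subset_Icc_self ht)))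
      (fun t ht => hmem Y hY t (Ico_subset_Icc_self ht))
      (by rw [(hc X hX).1, (hc Y hY).1, dist_self]) t ht
    rw [dist_eq_norm] at h
    refine h.trans ?_
    -- With Lipschitz constant 1 the bound is `M * ‖X - Y‖ * (exp t - 1)`, and `exp t ≤ 3` gives the
    -- factor 2.
    rw [gronwallBound_of_K_ne_0 (by simp)]
    have he : Real.exp t ≤ 3 := (Real.exp_le_exp.2 ht.2).trans (by
      have := Real.exp_one_lt_d9; linarith)
    have : 0 ≤ M * ‖X - Y‖ := by positivity
    simp only [NNReal.coe_one, zero_mul, zero_add, div_one, one_mul, sub_zero]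
    nlinarith
  rw [hasStrictFDerivAt_iff_isLittleO]
  rw [Asymptotics.isLittleO_iff]
  intro ε hε
  set C : ℝ := 3 * K * M with hC
  have hev : ∀ᶠ q : F × F in 𝓝 (0, 0), (‖q.1‖ < δ ∧ ‖q.2‖ < δ) ∧ C * ‖q.1‖ + C * ‖q.2‖ < ε := by
    refine Filter.Eventually.and (Filter.Eventually.and ?_ ?_) ?_
    · exact (continuous_fst.norm.tendsto (0, 0)).eventually (gt_mem_nhds (by simpa using hδ0))
    · exact (continuous_snd.norm.tendsto (0, 0)).eventually (gt_mem_nhds (by simpa using hδ0))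
    · have : Continuous fun q : F × F => C * ‖q.1‖ + C * ‖q.2‖ := by fun_prop
      exact (this.tendsto (0, 0)).eventually (gt_mem_nhds (by simpa using hε))
  filter_upwards [hev] with q hq
  obtain ⟨X, Y⟩ := q
  obtain ⟨⟨hX, hY⟩, hsm⟩ := hq
  simp only at hX hY hsm ⊢
  -- Strict differentiability says that this curve, which starts at 0, is small compared with `‖X -
  -- Y‖` at time 1. Its derivative splits into two terms, controlled by the distance of the
  -- solutions to each other and to `p`.
  have hder : ∀ t ∈ Icc (0 : ℝ) 1, HasDerivWithinAt (fun t => c X t - c Y t - t • A p (X - Y))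
      (A (c X t) X - A (c Y t) Y - (1 : ℝ) • A p (X - Y)) (Icc (0 : ℝ) 1) t := fun t ht =>
    ((hd X hX t ht).sub (hd Y hY t ht)).sub ((hasDerivWithinAt_id t _).smul_const _)
  have h := norm_image_sub_le_of_norm_deriv_le_segment' (C := ε * ‖X - Y‖) hder (fun t ht => by
    have ht := Ico_subset_Icc_self ht
    have e : A (c X t) X - A (c Y t) Y - (1 : ℝ) • A p (X - Y) =
        (A (c X t) - A (c Y t)) X + (A (c Y t) - A p) (X - Y) := by
      simp only [sub_apply, map_sub, one_smul]
      abel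
    rw [e]
    have h1 := hK'.dist_le_mul _ (hmem X hX t ht) _ (hmem Y hY t ht)
    have h2 := hK'.dist_le_mul _ (hmem Y hY t ht) _ (mem_closedBall_self hr.le)
    rw [dist_eq_norm, dist_eq_norm] at h1 h2
    have h3 := hlip X Y hX hY t ht
    have h4 := hclose Y hY t ht
    calc _ ≤ ‖A (c X t) - A (c Y t)‖ * ‖X‖ + ‖A (c Y t) - A p‖ * ‖X - Y‖ :=
          (norm_add_le _ _).trans (add_le_add (ContinuousLinearMap.le_opNorm _ _)
            (ContinuousLinearMap.le_opNorm _ _))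
      _ ≤ (K * (2 * M * ‖X - Y‖)) * ‖X‖ + (K * (M * ‖Y‖)) * ‖X - Y‖ := by
          gcongr
          · exact h1.trans (by gcongr)
          · exact h2.trans (by gcongr)
      _ = (2 * K * M * ‖X‖ + K * M * ‖Y‖) * ‖X - Y‖ := by ring
      _ ≤ ε * ‖X - Y‖ := by
          gcongr
          refine le_trans ?_ hsm.le
          rw [hC]
          have : 0 ≤ (K : ℝ) * M * ‖X‖ := by positivity
          have : 0 ≤ (K : ℝ) * M * ‖Y‖ := by positivity
          nlinarith) 1 (by simp)
  simpa [(hc X hX).1, (hc Y hY).1] using h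

end ParametricODE

/-! ### One-parameter subgroups as integral curves of left-invariant fields. -/

section OneParameterSubgroups

open Set Filter Topology

variable {m : ℕ} {G : Type*} [TopologicalSpace G] [ChartedSpace (EuclideanSpace ℝ (Fin m)) G]
  [Group G]

/-- `γ` is the one-parameter subgroup of `G` with initial velocity `X`. -/
structure IsOneParam (γ : ℝ → G) (X : LieAlg m G) : Prop where
  map_add : ∀ s t, γ (s + t) = γ s * γ t
  hasMFDerivAt_zero : HasMFDerivAt 𝓘(ℝ, ℝ) (𝓡 m) γ 0
    ((1 : ℝ →L[ℝ] ℝ).smulRight (X : EuclideanSpace ℝ (Fin m)) :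
      ℝ →L[ℝ] EuclideanSpace ℝ (Fin m))

namespace IsOneParam

variable {γ : ℝ → G} {X : LieAlg m G}

theorem map_zero (h : IsOneParam γ X) : γ 0 = 1 := by
  have := h.map_add 0 0
  simpa using this

theorem map_neg (h : IsOneParam γ X) (t : ℝ) : γ (-t) = (γ t)⁻¹ := by
  have := h.map_add (-t) t
  rw [neg_add_cancel, h.map_zero] at this
  exact eq_inv_of_mul_eq_one_left this.symm

end IsOneParam

variable [LieGroup (𝓡 m) ∞ G]

theorem mdifferentiable_mul_left_infty (a : G) : MDifferentiable (𝓡 m) (𝓡 m) (fun x : G => a * x) :=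
  (contMDiff_mul_left (I := 𝓡 m) (n := ∞) (a := a)).mdifferentiable (by simp)

theorem mfderiv_mul_left_mulInvariantVectorField (a x : G) (X : LieAlg m G) :
    (mfderiv (𝓡 m) (𝓡 m) (fun y : G => a * y) x :
      EuclideanSpace ℝ (Fin m) →L[ℝ] EuclideanSpace ℝ (Fin m)) (mulInvariantVectorField X x) =
      mulInvariantVectorField X (a * x) := by
  have h := mfderiv_comp_of_eq (I := 𝓡 m) (I' := 𝓡 m) (I'' := 𝓡 m) (x := (1 : G)) (y := x)
    (g := fun y : G => a * y) (f := fun y : G => x * y)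
    (mdifferentiable_mul_left_infty _ _) (mdifferentiable_mul_left_infty _ _) (mul_one x)
  have e : (fun y : G => a * y) ∘ (fun y : G => x * y) = fun y => a * x * y := by
    funext y; simp [mul_assoc]
  rw [e] at h
  -- The chain rule yields the differential at `x * 1`. Quantifying over the base point moves it to
  -- `x` without rewriting inside dependent tangent spaces.
  have e' : ∀ z, z = x → (mfderiv (𝓡 m) (𝓡 m) (fun y : G => a * y) z :
      EuclideanSpace ℝ (Fin m) →L[ℝ] EuclideanSpace ℝ (Fin m)) =
      mfderiv (𝓡 m) (𝓡 m) (fun y : G => a * y) x := by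
    rintro _ rfl; rfl
  refine (congrArg (fun L : EuclideanSpace ℝ (Fin m) →L[ℝ] EuclideanSpace ℝ (Fin m) =>
    L (mulInvariantVectorField X x)) (e' _ (mul_one x))).symm.trans ?_
  exact (congrArg (fun L : EuclideanSpace ℝ (Fin m) →L[ℝ] EuclideanSpace ℝ (Fin m) => L X) h).symm

theorem three_le_infty : (3 : WithTop ℕ∞) ≤ ∞ := by
  have : ((3 : ℕ∞) : WithTop ℕ∞) ≤ ((⊤ : ℕ∞) : WithTop ℕ∞) := WithTop.coe_le_coe.2 le_top
  exact this

theorem IsMIntegralCurveOn.mul_left {γ : ℝ → G} {X : LieAlg m G} {s : Set ℝ}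
    (h : IsMIntegralCurveOn γ (mulInvariantVectorField X) s) (a : G) :
    IsMIntegralCurveOn (fun t => a * γ t) (mulInvariantVectorField X) s := by
  intro t ht
  have h1 := (mdifferentiable_mul_left_infty a (γ t)).hasMFDerivAt.comp_hasMFDerivWithinAt t (h t ht)
  refine h1.congr_mfderiv ?_
  refine ContinuousLinearMap.ext fun (r : ℝ) => ?_
  have h2 := mfderiv_mul_left_mulInvariantVectorField a (γ t) X
  have h3 := congrArg (fun v : EuclideanSpace ℝ (Fin m) => r • v) h2
  refine Eq.trans ?_ h3
  exact (mfderiv (𝓡 m) (𝓡 m) (fun y : G => a * y) (γ t) :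
      EuclideanSpace ℝ (Fin m) →L[ℝ] EuclideanSpace ℝ (Fin m)).map_smul r _

theorem contMDiff_one_mulInvariantVectorField (X : LieAlg m G) :
    ContMDiff (𝓡 m) (𝓡 m).tangent 1
      (fun g : G => (⟨g, mulInvariantVectorField X g⟩ : TangentBundle (𝓡 m) G)) := by
  have : LieGroup (𝓡 m) (minSmoothness ℝ 3) G :=
    LieGroup.of_le (n := ∞) (by rw [minSmoothness_of_isRCLikeNormedField]; exact three_le_infty)
  have : LieGroup (𝓡 m) 3 G :=
    LieGroup.of_le (n := ∞) (by exact three_le_infty)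
  have := contMDiff_mulInvariantVectorField (I := 𝓡 m) X
  exact this.of_le (by rw [minSmoothness_of_isRCLikeNormedField]; norm_num)

namespace IsOneParam

variable {γ : ℝ → G} {X : LieAlg m G}

/-- Since γ(s) = γ(t) γ(s - t), the velocity at t is the left translate of the velocity at 0. -/
theorem isMIntegralCurve (h : IsOneParam γ X) :
    IsMIntegralCurve γ (mulInvariantVectorField X) := by
  intro t
  have h0 := h.hasMFDerivAt_zero
  have h1 : HasMFDerivAt 𝓘(ℝ, ℝ) 𝓘(ℝ, ℝ) (fun s : ℝ => s - t) t
      (ContinuousLinearMap.id ℝ ℝ) :=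
    (hasMFDerivAt_iff_hasFDerivAt).2 ((hasFDerivAt_id t).sub_const t)
  have h0' : HasMFDerivAt 𝓘(ℝ, ℝ) (𝓡 m) γ (t - t)
    ((1 : ℝ →L[ℝ] ℝ).smulRight (X : EuclideanSpace ℝ (Fin m)) :
      ℝ →L[ℝ] EuclideanSpace ℝ (Fin m)) := by rw [sub_self]; exact h0
  have h2 := HasMFDerivAt.comp (f := fun s : ℝ => s - t) t h0' h1
  have h3 : HasMFDerivAt (𝓡 m) (𝓡 m) (fun x : G => γ t * x) (γ (t - t))
      (mfderiv (𝓡 m) (𝓡 m) (fun x : G => γ t * x) 1 :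
        EuclideanSpace ℝ (Fin m) →L[ℝ] EuclideanSpace ℝ (Fin m)) := by
    rw [sub_self, h.map_zero]
    exact (mdifferentiable_mul_left_infty (γ t) 1).hasMFDerivAt
  have h4 := HasMFDerivAt.comp t h3 h2
  have e : (fun x : G => γ t * x) ∘ γ ∘ (fun s : ℝ => s - t) = γ := by
    funext s
    simp [← h.map_add]
  rw [e] at h4
  refine h4.congr_mfderiv ?_
  refine ContinuousLinearMap.ext fun (r : ℝ) => ?_
  exact (mfderiv (𝓡 m) (𝓡 m) (fun y : G => γ t * y) 1 :
      EuclideanSpace ℝ (Fin m) →L[ℝ] EuclideanSpace ℝ (Fin m)).map_smul r _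

theorem continuous (h : IsOneParam γ X) : Continuous γ := h.isMIntegralCurve.continuous

/-- Both t ↦ γ(s + t) and t ↦ γ(s) γ(t) are integral curves starting at γ(s), so they coincide. -/
theorem of_isMIntegralCurve [T2Space G] (h : IsMIntegralCurve γ (mulInvariantVectorField X))
    (h0 : γ 0 = 1) : IsOneParam γ X where
  map_add s t := by
    have h1 : IsMIntegralCurve (fun t => γ s * γ t) (mulInvariantVectorField X) := by
      rw [isMIntegralCurve_iff_isMIntegralCurveOn] at h ⊢
      exact h.mul_left _
    have h2 := h.comp_add s
    have := isMIntegralCurve_Ioo_eq_of_contMDiff_boundaryless (t₀ := 0)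
      (contMDiff_one_mulInvariantVectorField X) h2 h1 (by simp [h0])
    have := congrFun this t
    simpa [add_comm] using this
  hasMFDerivAt_zero := by
    have h1 := h 0
    have e : mulInvariantVectorField X (γ 0) = (X : EuclideanSpace ℝ (Fin m)) := by
      rw [h0]
      change mfderiv (𝓡 m) (𝓡 m) (fun x : G => 1 * x) 1 X = X
      have : (fun x : G => 1 * x) = id := by funext x; simp
      rw [this, mfderiv_id]
      rfl
    rw [e] at h1
    exact h1

/-- This turns identities between one-parameter subgroups into identities between their velocities,
which is how the conjugation and product formulas are exploited. -/
theorem unique [T2Space G] {γ' : ℝ → G} (h : IsOneParam γ X) (h' : IsOneParam γ' X) : γ = γ' :=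
  isMIntegralCurve_Ioo_eq_of_contMDiff_boundaryless (t₀ := 0)
    (contMDiff_one_mulInvariantVectorField X) h.isMIntegralCurve h'.isMIntegralCurve
    (by rw [h.map_zero, h'.map_zero])

theorem conj (h : IsOneParam γ X) (a : G) : IsOneParam (fun t => a * γ t * a⁻¹) (Ad m a X) where
  map_add s t := by simp [h.map_add]
  hasMFDerivAt_zero := by
    have h3 : HasMFDerivAt (𝓡 m) (𝓡 m) (fun x : G => a * x * a⁻¹) (γ 0)
        (Ad m a : EuclideanSpace ℝ (Fin m) →L[ℝ] EuclideanSpace ℝ (Fin m)) := by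
      rw [h.map_zero]
      exact (mdifferentiable_conj a 1).hasMFDerivAt
    have h4 := HasMFDerivAt.comp 0 h3 h.hasMFDerivAt_zero
    refine h4.congr_mfderiv ?_
    refine ContinuousLinearMap.ext fun (r : ℝ) => ?_
    exact (Ad m a : EuclideanSpace ℝ (Fin m) →L[ℝ] EuclideanSpace ℝ (Fin m)).map_smul r _

omit [LieGroup (𝓡 m) ∞ G] in
theorem comp_mul (h : IsOneParam γ X) (c : ℝ) : IsOneParam (fun t => γ (c * t)) (c • X) where
  map_add s t := by simp [mul_add, h.map_add]
  hasMFDerivAt_zero := by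
    have h1 : HasMFDerivAt 𝓘(ℝ, ℝ) 𝓘(ℝ, ℝ) (fun s : ℝ => c * s) 0
        (c • ContinuousLinearMap.id ℝ ℝ) :=
      (hasMFDerivAt_iff_hasFDerivAt).2 ((hasFDerivAt_id (0 : ℝ)).const_mul c)
    have h0 : HasMFDerivAt 𝓘(ℝ, ℝ) (𝓡 m) γ (c * 0)
      ((1 : ℝ →L[ℝ] ℝ).smulRight (X : EuclideanSpace ℝ (Fin m)) :
        ℝ →L[ℝ] EuclideanSpace ℝ (Fin m)) := by rw [mul_zero]; exact h.hasMFDerivAt_zero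
    refine (HasMFDerivAt.comp 0 h0 h1).congr_mfderiv ?_
    refine ContinuousLinearMap.ext fun (r : ℝ) => ?_
    exact (congrArg (· • (X : EuclideanSpace ℝ (Fin m))) (mul_comm c r)).trans
      (mul_smul r c (X : EuclideanSpace ℝ (Fin m)))

/-- Commutation makes the product a homomorphism; velocities add because the differential of
multiplication at (1, 1) is addition. -/
theorem mul {γ' : ℝ → G} {Y : LieAlg m G} (h : IsOneParam γ X) (h' : IsOneParam γ' Y)
    (hc : ∀ s t, Commute (γ s) (γ' t)) : IsOneParam (fun t => γ t * γ' t) (X + Y) where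
  map_add s t := by
    rw [h.map_add, h'.map_add, mul_assoc, mul_assoc, ← mul_assoc (γ t), (hc t s).eq, mul_assoc]
  hasMFDerivAt_zero := by
    have hm : MDifferentiableAt ((𝓡 m).prod (𝓡 m)) (𝓡 m) (fun q : G × G => q.1 * q.2) (1, 1) :=
      (contMDiff_mul (𝓡 m) ∞).mdifferentiable (by simp) _
    have h1 : HasMFDerivAt ((𝓡 m).prod (𝓡 m)) (𝓡 m) (fun q : G × G => q.1 * q.2) (γ 0, γ' 0)
        (mfderiv ((𝓡 m).prod (𝓡 m)) (𝓡 m) (fun q : G × G => q.1 * q.2) (1, 1) :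
          EuclideanSpace ℝ (Fin m) × EuclideanSpace ℝ (Fin m) →L[ℝ] EuclideanSpace ℝ (Fin m)) := by
      rw [h.map_zero, h'.map_zero]
      exact hm.hasMFDerivAt
    have h2 := h.hasMFDerivAt_zero.prodMk h'.hasMFDerivAt_zero
    refine (HasMFDerivAt.comp 0 h1 h2).congr_mfderiv ?_
    refine ContinuousLinearMap.ext fun (r : ℝ) => ?_
    have h3 := mfderiv_prod_eq_add_apply (v := ((r • (X : EuclideanSpace ℝ (Fin m)),
      r • (Y : EuclideanSpace ℝ (Fin m))) :
      EuclideanSpace ℝ (Fin m) × EuclideanSpace ℝ (Fin m))) hm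
    have e1 : (mfderiv (𝓡 m) (𝓡 m) (fun z : G => z * 1) 1 :
        EuclideanSpace ℝ (Fin m) →L[ℝ] EuclideanSpace ℝ (Fin m)) = .id ℝ _ := by
      rw [show (fun z : G => z * 1) = id by funext z; simp]
      exact mfderiv_id
    have e2 : (mfderiv (𝓡 m) (𝓡 m) (fun z : G => 1 * z) 1 :
        EuclideanSpace ℝ (Fin m) →L[ℝ] EuclideanSpace ℝ (Fin m)) = .id ℝ _ := by
      rw [show (fun z : G => 1 * z) = id by funext z; simp]
      exact mfderiv_id
    refine Eq.trans h3 ?_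
    refine (congrArg₂ (fun L L' : EuclideanSpace ℝ (Fin m) →L[ℝ] EuclideanSpace ℝ (Fin m) =>
      L (r • (X : EuclideanSpace ℝ (Fin m))) + L' (r • (Y : EuclideanSpace ℝ (Fin m)))) e1 e2).trans ?_
    exact (smul_add r (X : EuclideanSpace ℝ (Fin m)) Y).symm

end IsOneParam

end OneParameterSubgroups

/-! ### The exponential map near 0 and smoothness of one-parameter subgroups. -/

section Exponential

open Set Filter Topology

variable {m : ℕ} {G : Type*} [TopologicalSpace G] [ChartedSpace (EuclideanSpace ℝ (Fin m)) G]
  [Group G]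

variable [LieGroup (𝓡 m) ∞ G]

omit [LieGroup (𝓡 m) ∞ G] in
theorem IsOneParam.congr_velocity {γ : ℝ → G} {X Y : LieAlg m G} (h : IsOneParam γ X)
    (e : X = Y) : IsOneParam γ Y := e ▸ h

/-- The differential at `1` of `f : G → G`, in the chart of the target at `z`. -/
noncomputable def chartDeriv (f : G → G) (z : G) : Mdl m →L[ℝ] Mdl m :=
  (mfderiv (𝓡 m) 𝓘(ℝ, Mdl m) (extChartAt (𝓡 m) z) (f 1) : Mdl m →L[ℝ] Mdl m).comp
    (mfderiv (𝓡 m) (𝓡 m) f 1 : Mdl m →L[ℝ] Mdl m)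

/-- The differentials at `1` of a smooth family of maps depend smoothly on the parameter. -/
theorem contMDiffAt_chartDeriv {f : G → G → G}
    (hf : ContMDiff ((𝓡 m).prod (𝓡 m)) (𝓡 m) ∞ (Function.uncurry f)) (g₀ : G) :
    ContMDiffAt (𝓡 m) 𝓘(ℝ, Mdl m →L[ℝ] Mdl m) ∞
      (fun g => chartDeriv (m := m) (f g) (f g₀ 1)) g₀ := by
  have h := ContMDiffAt.mfderiv (x₀ := g₀) f (fun _ => (1 : G)) hf.contMDiffAt
    (contMDiffAt_const (I := 𝓡 m) (I' := 𝓡 m)) (m := ∞) (by simp)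
  refine h.congr_of_eventuallyEq ?_
  have hc : Continuous fun g => f g 1 :=
    hf.continuous.comp (by fun_prop : Continuous fun g : G => (g, (1 : G)))
  filter_upwards [hc.continuousAt.preimage_mem_nhds (chart_source_mem_nhds (Mdl m) (f g₀ 1))] with g hg
  have h1 := inTangentCoordinates_eq_mfderiv_comp (I := 𝓡 m) (I' := 𝓡 m) (x₀ := g₀) (x := g)
    (f := fun _ : G => (1 : G))
    (g := fun g => f g 1) (ϕ := fun x => mfderiv (𝓡 m) (𝓡 m) (f x) 1)
    (mem_chart_source _ _) hg
  refine Eq.trans ?_ h1.symm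
  have h2 := mfderivWithin_range_extChartAt_symm (I := 𝓡 m) (x := (1 : G))
  exact (congrArg (fun L : Mdl m →L[ℝ] Mdl m =>
    (mfderiv (𝓡 m) 𝓘(ℝ, Mdl m) (extChartAt (𝓡 m) (f g₀ 1)) (f g 1) : Mdl m →L[ℝ] Mdl m).comp
      ((mfderiv (𝓡 m) (𝓡 m) (f g) 1 : Mdl m →L[ℝ] Mdl m).comp L)) h2).symm

/-- The differential of the preferred chart at its own base point is the identity. -/
theorem chartDeriv_self (f : G → G) {z : G} (hz : f 1 = z) :
    chartDeriv (m := m) f z = (mfderiv (𝓡 m) (𝓡 m) f 1 : Mdl m →L[ℝ] Mdl m) := by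
  subst hz
  exact congrArg (fun L : Mdl m →L[ℝ] Mdl m => L.comp (mfderiv (𝓡 m) (𝓡 m) f 1 : Mdl m →L[ℝ] Mdl m))
    (mfderiv_extChartAt_self (I := 𝓡 m) (x := f 1))

/-- The left-invariant vector fields on `G` in the chart at `1`, as a linear function of the value
at `1`. -/
noncomputable def chartFrame (m : ℕ) (G : Type*) [TopologicalSpace G]
    [ChartedSpace (EuclideanSpace ℝ (Fin m)) G] [Group G] (y : Mdl m) : Mdl m →L[ℝ] Mdl m :=
  chartDeriv (fun x : G => (extChartAt (𝓡 m) (1 : G)).symm y * x) 1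

theorem contDiffAt_chartFrame : ContDiffAt ℝ ∞ (chartFrame m G) (extChartAt (𝓡 m) (1 : G) 1) := by
  have h := contMDiffAt_chartDeriv (m := m) (f := fun g x : G => g * x)
    (contMDiff_mul (𝓡 m) ∞) (1 : G)
  rw [one_mul] at h
  have hs : ContMDiffAt 𝓘(ℝ, Mdl m) (𝓡 m) ∞ (extChartAt (𝓡 m) (1 : G)).symm
      (extChartAt (𝓡 m) (1 : G) 1) :=
    (contMDiffOn_extChartAt_symm (1 : G)).contMDiffAt (extChartAt_target_mem_nhds (1 : G))
  exact (ContMDiffAt.comp_of_eq h hs (extChartAt_to_inv (1 : G))).contDiffAt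

theorem chartFrame_one : chartFrame m G (extChartAt (𝓡 m) (1 : G) 1) = .id ℝ _ := by
  rw [chartFrame, extChartAt_to_inv, show (fun z : G => 1 * z) = id by funext z; simp,
    chartDeriv_self (z := 1) id rfl]
  exact mfderiv_id

omit [LieGroup (𝓡 m) ∞ G] in
theorem chartFrame_apply (g : G) (hg : g ∈ (extChartAt (𝓡 m) (1 : G)).source) (X : Mdl m) :
    chartFrame m G (extChartAt (𝓡 m) (1 : G) g) X =
      (mfderiv (𝓡 m) 𝓘(ℝ, Mdl m) (extChartAt (𝓡 m) (1 : G)) g : Mdl m →L[ℝ] Mdl m)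
        (mulInvariantVectorField (I := 𝓡 m) (G := G) X g) := by
  have e : ∀ z : G, z = g → (mfderiv (𝓡 m) 𝓘(ℝ, Mdl m)
      (extChartAt (𝓡 m) (1 : G)) z : Mdl m →L[ℝ] Mdl m) =
      mfderiv (𝓡 m) 𝓘(ℝ, Mdl m) (extChartAt (𝓡 m) (1 : G)) g := by
    rintro _ rfl; rfl
  rw [chartFrame, (extChartAt (𝓡 m) (1 : G)).left_inv hg]
  exact congrArg (fun L : Mdl m →L[ℝ] Mdl m => L (mulInvariantVectorField (I := 𝓡 m) (G := G) X g))
    (e _ (mul_one g))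

/-- A one-parameter subgroup solves the ODE given by `chartFrame`. -/
theorem IsOneParam.hasDerivAt_chart {γ : ℝ → G} {X : LieAlg m G} (h : IsOneParam γ X) {t : ℝ}
    (ht : γ t ∈ (extChartAt (𝓡 m) (1 : G)).source) :
    HasDerivAt (fun t => extChartAt (𝓡 m) (1 : G) (γ t))
      (chartFrame m G (extChartAt (𝓡 m) (1 : G) (γ t)) X) t := by
  have h1 : HasMFDerivAt (𝓡 m) 𝓘(ℝ, Mdl m) (extChartAt (𝓡 m) (1 : G)) (γ t)
      (mfderiv (𝓡 m) 𝓘(ℝ, Mdl m) (extChartAt (𝓡 m) (1 : G)) (γ t)) :=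
    (mdifferentiableAt_extChartAt (by simpa using ht)).hasMFDerivAt
  have h2 := HasMFDerivAt.comp t h1 (h.isMIntegralCurve t)
  obtain ⟨A, hA⟩ : ∃ A : Mdl m →L[ℝ] Mdl m,
    A = mfderiv (𝓡 m) 𝓘(ℝ, Mdl m) (extChartAt (𝓡 m) (1 : G)) (γ t) := ⟨_, rfl⟩
  obtain ⟨v, hv⟩ : ∃ v : Mdl m, v = mulInvariantVectorField X (γ t) := ⟨_, rfl⟩
  have h3 : HasFDerivAt (fun t => extChartAt (𝓡 m) (1 : G) (γ t))
      (A.comp ((1 : ℝ →L[ℝ] ℝ).smulRight v)) t := by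
    subst hA hv
    exact hasMFDerivAt_iff_hasFDerivAt.1 h2
  refine h3.hasDerivAt.congr_deriv (Eq.trans ?_ (chartFrame_apply _ ht _).symm)
  subst hA hv
  exact congrArg _ (one_smul ℝ (mulInvariantVectorField X (γ t) : Mdl m))

/-- Conversely, a solution of the ODE given by `chartFrame` is an integral curve. -/
theorem isMIntegralCurveOn_symm_chart {c : ℝ → Mdl m} {X : LieAlg m G}
    {s : Set ℝ}
    (hc : ∀ t ∈ s, c t ∈ (extChartAt (𝓡 m) (1 : G)).target ∧
      HasDerivWithinAt c (chartFrame m G (c t) X) s t) :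
    IsMIntegralCurveOn (fun t => (extChartAt (𝓡 m) (1 : G)).symm (c t))
      (mulInvariantVectorField X) s := by
  intro t ht
  obtain ⟨hm, hd⟩ := hc t ht
  have h1 : HasMFDerivAt 𝓘(ℝ, Mdl m) (𝓡 m) (extChartAt (𝓡 m) (1 : G)).symm (c t)
      (mfderivWithin 𝓘(ℝ, Mdl m) (𝓡 m) (extChartAt (𝓡 m) (1 : G)).symm
        (range (𝓡 m)) (c t)) := by
    have := (mdifferentiableWithinAt_extChartAt_symm (I := 𝓡 m) hm).hasMFDerivWithinAt
    refine this.hasMFDerivAt ?_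
    simp
  have h2 : HasMFDerivWithinAt 𝓘(ℝ, ℝ) 𝓘(ℝ, Mdl m) c s t _ :=
    hasMFDerivWithinAt_iff_hasFDerivWithinAt.2 hd.hasFDerivWithinAt
  refine (h1.comp_hasMFDerivWithinAt t h2).congr_mfderiv ?_
  have h3 := mfderivWithin_extChartAt_symm_comp_mfderiv_extChartAt (I := 𝓡 m) hm
  have h4 := congrArg (fun L : Mdl m →L[ℝ] Mdl m =>
    L (mulInvariantVectorField X ((extChartAt (𝓡 m) (1 : G)).symm (c t)))) h3
  have h5 := chartFrame_apply _ ((extChartAt (𝓡 m) (1 : G)).map_target hm) X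
  rw [(extChartAt (𝓡 m) (1 : G)).right_inv hm] at h5
  have h6 := (congrArg (mfderivWithin 𝓘(ℝ, Mdl m) (𝓡 m) (extChartAt (𝓡 m) (1 : G)).symm
        (range (𝓡 m)) (c t) : Mdl m →L[ℝ] Mdl m) h5).trans h4
  refine ContinuousLinearMap.ext fun (r : ℝ) => ?_
  refine Eq.trans ?_ (congrArg (fun v : Mdl m => r • v) h6)
  exact (mfderivWithin 𝓘(ℝ, Mdl m) (𝓡 m) (extChartAt (𝓡 m) (1 : G)).symm
        (range (𝓡 m)) (c t) : Mdl m →L[ℝ] Mdl m).map_smul r _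

variable [T2Space G]

/-- Local form of the exponential map: the one-parameter subgroups with small initial velocity
exist, stay in the chart at `1` until time `1`, and their values at time `1` depend on the initial
velocity in a strictly differentiable way. -/
theorem exists_isOneParam_small : ∃ δ > 0, ∃ γ : Mdl m → ℝ → G,
    (∀ X : Mdl m, ‖X‖ < δ → IsOneParam (m := m) (γ X) X ∧
      γ X 1 ∈ (extChartAt (𝓡 m) (1 : G)).source) ∧
    HasStrictFDerivAt (fun X : Mdl m => extChartAt (𝓡 m) (1 : G) (γ X 1))
      (.id ℝ (Mdl m)) 0 := by
  obtain ⟨δ, hδ, c, hc, hs⟩ := exists_integralCurve_hasStrictFDerivAt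
    ((contDiffAt_chartFrame (m := m) (G := G)).of_le (by simp))
    (extChartAt_target_mem_nhds (I := 𝓡 m) (1 : G))
  rw [chartFrame_one] at hs
  have hex : ∀ X : Mdl m, ‖X‖ < δ → ∃ γ : ℝ → G, IsOneParam (m := m) γ X ∧
      γ 1 = (extChartAt (𝓡 m) (1 : G)).symm (c X 1) := by
    intro X hX
    obtain ⟨h0, hc⟩ := hc X hX
    have h1 : IsMIntegralCurveOn (fun t => (extChartAt (𝓡 m) (1 : G)).symm (c X t))
      (mulInvariantVectorField X) (Ioo (-2) 2) :=
      isMIntegralCurveOn_symm_chart fun t ht =>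
        ⟨(hc t (Ioo_subset_Icc_self ht)).1, (hc t (Ioo_subset_Icc_self ht)).2.mono Ioo_subset_Icc_self⟩
    -- Left translation gives an integral curve on (-2, 2) through every point; this uniform
    -- lifetime makes the field complete.
    obtain ⟨γ, hγ0, hγ⟩ := exists_isMIntegralCurve_of_isMIntegralCurveOn
      (contMDiff_one_mulInvariantVectorField X) (ε := 2) (by norm_num)
      (fun x => ⟨_, by simp [h0], h1.mul_left x⟩) 1
    refine ⟨γ, .of_isMIntegralCurve hγ hγ0, ?_⟩
    exact isMIntegralCurveOn_Ioo_eqOn_of_contMDiff_boundaryless (t₀ := 0) (by norm_num)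
      (contMDiff_one_mulInvariantVectorField X) (hγ.isMIntegralCurveOn _) h1
      (by simp [hγ0, h0]) (by norm_num : (1 : ℝ) ∈ Ioo (-2 : ℝ) 2)
  choose! γ hγ using hex
  have hm : ∀ X : Mdl m, ‖X‖ < δ → c X 1 ∈ (extChartAt (𝓡 m) (1 : G)).target := fun X hX =>
    ((hc X hX).2 1 (by norm_num)).1
  refine ⟨δ, hδ, γ, fun X hX => ⟨(hγ X hX).1, ?_⟩, ?_⟩
  · rw [(hγ X hX).2]
    exact (extChartAt (𝓡 m) (1 : G)).map_target (hm X hX)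
  · refine hs.congr_of_eventuallyEq ?_
    filter_upwards [Metric.ball_mem_nhds (0 : Mdl m) hδ] with X hX
    have hX : ‖X‖ < δ := by simpa using hX
    rw [(hγ X hX).2, (extChartAt (𝓡 m) (1 : G)).right_inv (hm X hX)]

/-- Small velocities suffice: scale X down, then speed up time. -/
theorem exists_isOneParam (X : Mdl m) : ∃ γ : ℝ → G, IsOneParam (m := m) γ X := by
  obtain ⟨δ, hδ, γ, hγ, -⟩ := exists_isOneParam_small (m := m) (G := G)
  obtain ⟨r, hr0, hr⟩ : ∃ r : ℝ, 0 < r ∧ ‖r • X‖ < δ := by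
    refine ⟨δ / (2 * (‖X‖ + 1)), by positivity, ?_⟩
    rw [norm_smul, Real.norm_of_nonneg (by positivity), div_mul_eq_mul_div, div_lt_iff₀ (by positivity)]
    nlinarith [norm_nonneg X]
  refine ⟨_, (?_ : IsOneParam (fun t => γ (r • X) (r⁻¹ * t)) X)⟩
  have := (hγ _ hr).1.comp_mul r⁻¹
  have e : r⁻¹ • r • X = X := by rw [smul_smul, inv_mul_cancel₀ hr0.ne', one_smul]
  exact this.congr_velocity e

/-- The one-parameter subgroup with initial velocity `X`. -/
noncomputable def oneParam (X : LieAlg m G) : ℝ → G :=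
  (exists_isOneParam (m := m) (G := G) X).choose

theorem isOneParam_oneParam (X : LieAlg m G) : IsOneParam (oneParam X) X :=
  (exists_isOneParam (m := m) (G := G) X).choose_spec

/-- The exponential map is injective near `0`, and maps neighbourhoods of `0` to neighbourhoods
of `1`. -/
theorem oneParam_one_local : (∃ δ > 0, InjOn (fun X : Mdl m => oneParam (G := G) X 1)
      (Metric.ball 0 δ)) ∧
    ∀ V ∈ 𝓝 (0 : Mdl m), (fun X : Mdl m => oneParam (G := G) X 1) '' V ∈ 𝓝 (1 : G) := by
  obtain ⟨δ, hδ, γ, hγ, hs⟩ := exists_isOneParam_small (m := m) (G := G)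
  have he : ∀ X : Mdl m, ‖X‖ < δ → oneParam (G := G) X = γ X := fun X hX =>
    (isOneParam_oneParam X).unique (hγ X hX).1
  have hs' : HasStrictFDerivAt
      (fun X : Mdl m => extChartAt (𝓡 m) (1 : G) (γ X 1))
      ((ContinuousLinearEquiv.refl ℝ (Mdl m) :
        Mdl m ≃L[ℝ] Mdl m) :
        Mdl m →L[ℝ] Mdl m) 0 := hs
  have hb : Metric.ball (0 : Mdl m) δ ∈ 𝓝 (0 : Mdl m) := Metric.ball_mem_nhds _ hδ
  -- The subgroup of velocity 0 equals its own reparametrization t ↦ γ(0 · t), hence is constant.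
  have h0 : γ 0 1 = 1 := by
    have h1 := (hγ 0 (by simpa using hδ)).1
    have h2 := h1.comp_mul 0
    have h3 := h1.unique (h2.congr_velocity (zero_smul ℝ (0 : Mdl m)))
    rw [h3]
    simp [h1.map_zero]
  constructor
  · have hsrc := hs'.mem_toOpenPartialHomeomorph_source
    have hinj := (hs'.toOpenPartialHomeomorph _).injOn
    obtain ⟨r, hr, hr'⟩ := Metric.mem_nhds_iff.1
      (inter_mem ((hs'.toOpenPartialHomeomorph _).open_source.mem_nhds hsrc) hb)
    refine ⟨r, hr, fun X hX Y hY hXY => ?_⟩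
    have hX' := hr' hX
    have hY' := hr' hY
    refine hinj hX'.1 hY'.1 ?_
    dsimp only at hXY
    rw [he X (by simpa using hX'.2), he Y (by simpa using hY'.2)] at hXY
    exact congrArg (extChartAt (𝓡 m) (1 : G)) hXY
  · intro V hV
    have h1 := hs'.map_nhds_eq_of_equiv
    have h2 := image_mem_map (m := fun X : Mdl m =>
      extChartAt (𝓡 m) (1 : G) (γ X 1)) (inter_mem hV hb)
    rw [show Filter.map _ (𝓝 (0 : Mdl m)) = _ from h1] at h2
    have h3 := (continuousAt_extChartAt (I := 𝓡 m) (1 : G)).preimage_mem_nhds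
      (t := (fun X : Mdl m => extChartAt (𝓡 m) (1 : G) (γ X 1)) ''
        (V ∩ Metric.ball 0 δ)) (by rw [← h0]; simpa [h0] using h2)
    filter_upwards [h3, extChartAt_source_mem_nhds (I := 𝓡 m) (1 : G)] with g hg hg'
    obtain ⟨X, ⟨hXV, hXδ⟩, hX⟩ := hg
    have hXδ : ‖X‖ < δ := by simpa using hXδ
    refine ⟨X, hXV, ?_⟩
    dsimp only
    rw [he X hXδ]
    exact (extChartAt (𝓡 m) (1 : G)).injOn (hγ X hXδ).2 hg' hX

omit [T2Space G] in
/-- One-parameter subgroups are smooth. -/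
theorem IsOneParam.contMDiff {γ : ℝ → G} {X : LieAlg m G} (h : IsOneParam γ X) :
    ContMDiff 𝓘(ℝ, ℝ) (𝓡 m) ∞ γ := by
  rw [contMDiff_infty]
  intro n
  have h0 : ContMDiffAt 𝓘(ℝ, ℝ) (𝓡 m) n γ 0 := by
    -- The neighbourhood `u` depends on `n`, which is why regularity is proved for one finite `n` at
    -- a time.
    obtain ⟨u, hu, hA⟩ := (contDiffAt_chartFrame (m := m) (G := G)).contDiffOn (m := n)
      (by exact_mod_cast le_top) (by simp)
    have hsrc : ∀ᶠ t in 𝓝 (0 : ℝ), γ t ∈ (extChartAt (𝓡 m) (1 : G)).source :=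
      h.continuous.continuousAt.preimage_mem_nhds
        (by rw [h.map_zero]; exact extChartAt_source_mem_nhds (I := 𝓡 m) (1 : G))
    have hmem : ∀ᶠ t in 𝓝 (0 : ℝ), extChartAt (𝓡 m) (1 : G) (γ t) ∈ u := by
      have h1 : ContinuousAt (extChartAt (𝓡 m) (1 : G)) (γ 0) := by
        rw [h.map_zero]; exact continuousAt_extChartAt (I := 𝓡 m) (1 : G)
      refine (h1.comp h.continuous.continuousAt).preimage_mem_nhds ?_
      simpa [h.map_zero] using hu
    obtain ⟨τ, hτ, hball⟩ := Metric.nhds_basis_closedBall.mem_iff.1 (hsrc.and hmem)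
    rw [Real.closedBall_eq_Icc, zero_sub, zero_add] at hball
    have h2 : ContDiffOn ℝ (n : ℕ∞) (fun t => extChartAt (𝓡 m) (1 : G) (γ t)) (Icc (-τ) τ) := by
      refine ODE.contDiffOn_enat_Icc_of_hasDerivWithinAt
        (f := fun _ y => chartFrame m G y X) (u := u) ?_ (fun t ht =>
          (h.hasDerivAt_chart (hball ht).1).hasDerivWithinAt) (fun t ht => (hball ht).2)
      have h3 : ContDiffOn ℝ n (fun q : ℝ × Mdl m => chartFrame m G q.2)
        (Icc (-τ) τ ×ˢ u) := hA.comp contDiff_snd.contDiffOn fun q hq => hq.2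
      exact h3.clm_apply contDiffOn_const
    have hI : Icc (-τ) τ ∈ 𝓝 (0 : ℝ) := Icc_mem_nhds (by linarith) hτ
    have h3 : ContMDiffAt 𝓘(ℝ, ℝ) 𝓘(ℝ, Mdl m) n
      (fun t => extChartAt (𝓡 m) (1 : G) (γ t)) 0 := (h2.contDiffAt hI).contMDiffAt
    have hs : ContMDiffAt 𝓘(ℝ, Mdl m) (𝓡 m) n (extChartAt (𝓡 m) (1 : G)).symm
        (extChartAt (𝓡 m) (1 : G) 1) :=
      ((contMDiffOn_extChartAt_symm (n := ∞) (1 : G)).contMDiffAt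
        (extChartAt_target_mem_nhds (1 : G))).of_le (by exact_mod_cast le_top)
    refine (ContMDiffAt.comp_of_eq hs h3 (by rw [h.map_zero])).congr_of_eventuallyEq ?_
    filter_upwards [hsrc] with t ht
    exact ((extChartAt (𝓡 m) (1 : G)).left_inv ht).symm
  -- Smoothness at 0 is carried to t by γ(s) = γ(t) γ(s - t).
  intro t
  have h1 : ContMDiffAt 𝓘(ℝ, ℝ) 𝓘(ℝ, ℝ) n (fun s : ℝ => s - t) t :=
    (contDiff_id.sub contDiff_const).contDiffAt.contMDiffAt
  have h2 := ContMDiffAt.comp_of_eq h0 h1 (sub_self t)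
  have h3 := ((contMDiff_mul_left (I := 𝓡 m) (n := ∞) (a := γ t)).of_le
    (by exact_mod_cast le_top : (n : WithTop ℕ∞) ≤ ∞)).contMDiffAt.comp t h2
  refine h3.congr_of_eventuallyEq (Eventually.of_forall fun s => ?_)
  simp [← h.map_add]

end Exponential

/-! ### Density of the directions tangent to circle subgroups. -/

section CircleDirections

open Set Filter Topology

variable {m : ℕ} {G : Type*} [TopologicalSpace G] [ChartedSpace (EuclideanSpace ℝ (Fin m)) G]
  [Group G] [LieGroup (𝓡 m) ∞ G]

theorem Ad_mul (a b : G) (X : LieAlg m G) : Ad m (a * b) X = Ad m a (Ad m b X) := by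
  have h := mfderiv_comp_of_eq (I := 𝓡 m) (I' := 𝓡 m) (I'' := 𝓡 m) (x := (1 : G))
    (y := b * 1 * b⁻¹) (g := fun x : G => a * x * a⁻¹) (f := fun x : G => b * x * b⁻¹)
    (mdifferentiable_conj a _) (mdifferentiable_conj b _) rfl
  have e : (fun x : G => a * x * a⁻¹) ∘ (fun x : G => b * x * b⁻¹) =
      fun x : G => a * b * x * (a * b)⁻¹ := by
    funext y; simp [mul_assoc]
  rw [e] at h
  have e' : ∀ z : G, z = 1 → (mfderiv (𝓡 m) (𝓡 m) (fun y : G => a * y * a⁻¹) z :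
      Mdl m →L[ℝ] Mdl m) = mfderiv (𝓡 m) (𝓡 m) (fun y : G => a * y * a⁻¹) 1 := by
    rintro _ rfl; rfl
  refine (congrArg (fun L : Mdl m →L[ℝ] Mdl m => L X) h).trans ?_
  exact congrArg (fun L : Mdl m →L[ℝ] Mdl m => L (Ad m b X)) (e' _ (by simp))

/-- Conjugation fixes 1, so in the chart at 1 the smooth family of differentials is `Ad` itself. -/
theorem continuous_Ad : Continuous (fun a => Ad m a : G → (Mdl m →L[ℝ] Mdl m)) := by
  have hf : ContMDiff ((𝓡 m).prod (𝓡 m)) (𝓡 m) ∞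
      (Function.uncurry fun a x : G => a * x * a⁻¹) :=
    (contMDiff_fst.mul contMDiff_snd).mul contMDiff_fst.inv
  rw [continuous_iff_continuousAt]
  intro a₀
  have h := (contMDiffAt_chartDeriv hf a₀).continuousAt
  have e : ∀ a : G, chartDeriv (m := m) (fun x : G => a * x * a⁻¹) (a₀ * 1 * a₀⁻¹) =
      (Ad m a : Mdl m →L[ℝ] Mdl m) := fun a => by
    rw [show a₀ * 1 * a₀⁻¹ = 1 by simp]
    exact chartDeriv_self _ (by simp)
  exact (funext e : (fun a : G => chartDeriv (m := m) (fun x : G => a * x * a⁻¹)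
    (a₀ * 1 * a₀⁻¹)) = _) ▸ h

/-- A homomorphism from `ℝ` to a compact group returns to any neighbourhood of `1`. -/
theorem exists_ge_mem_of_compact [IsTopologicalGroup G] [CompactSpace G] {γ : ℝ → G}
    (hγ : ∀ s t, γ (s + t) = γ s * γ t) {U : Set G} (hU : U ∈ 𝓝 (1 : G)) {T : ℝ} (hT : 0 < T) :
    ∃ t ≥ T, γ t ∈ U := by
  -- Two terms γ(kT), γ(lT), k < l, close to the same cluster point have quotient γ((l - k)T) close
  -- to 1, and (l - k)T ≥ T.
  obtain ⟨x, hx⟩ : ∃ x : G, MapClusterPt x atTop (fun n : ℕ => γ (n * T)) :=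
    exists_clusterPt_of_compactSpace _
  have hc : Tendsto (fun q : G × G => q.1⁻¹ * q.2) (𝓝 (x, x)) (𝓝 1) := by
    have : Continuous fun q : G × G => q.1⁻¹ * q.2 := by fun_prop
    simpa using this.tendsto (x, x)
  have h1 := hc hU
  rw [nhds_prod_eq] at h1
  obtain ⟨V, hV, W, hW, hVW⟩ := Filter.mem_prod_iff.1 h1
  have hf := hx.frequently (inter_mem hV hW)
  obtain ⟨k, -, hk⟩ := Filter.frequently_atTop.1 hf 0
  obtain ⟨l, hl, hl'⟩ := Filter.frequently_atTop.1 hf (k + 1)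
  refine ⟨(l - k) * T, ?_, ?_⟩
  · have : (k : ℝ) + 1 ≤ l := by exact_mod_cast hl
    nlinarith
  · have h2 : (γ (k * T))⁻¹ * γ (l * T) ∈ U := @hVW (γ (k * T), γ (l * T)) ⟨hk.1, hl'.2⟩
    have h3 : γ (l * T) = γ (k * T) * γ ((l - k) * T) := by
      rw [← hγ]; congr 1; ring
    rwa [h3, inv_mul_cancel_left] at h2

/-- Velocities of periodic one-parameter subgroups are dense. -/
theorem exists_periodic_near [T2Space G] [CompactSpace G] (X : Mdl m) {ε : ℝ} (hε : 0 < ε) :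
    ∃ Y : Mdl m, ‖Y - X‖ < ε ∧ ∃ T : ℝ, 0 < T ∧ oneParam (m := m) (G := G) Y T = 1 := by
  have : IsTopologicalGroup G := topologicalGroup_of_lieGroup (𝓡 m) ∞
  obtain ⟨⟨δ, hδ, hinj⟩, hopen⟩ := oneParam_one_local (m := m) (G := G)
  let A : G → (Mdl m →L[ℝ] Mdl m) := fun a => Ad m a
  obtain ⟨C, hC⟩ : ∃ C : ℝ, ∀ a : G, ‖A a‖ ≤ C := by
    have hA : Continuous A := continuous_Ad
    obtain ⟨C, hC⟩ := isCompact_univ.exists_bound_of_continuousOn hA.continuousOn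
    exact ⟨C, fun a => hC a (mem_univ a)⟩
  have hC0 : 0 ≤ C := (norm_nonneg _).trans (hC 1)
  -- The bound 1 serves the estimate of Z/t; the other puts both Z and its conjugates `Ad a Z` into
  -- the ball where exp is injective.
  set r : ℝ := min 1 (δ / (C + 1)) with hr
  have hr0 : 0 < r := lt_min one_pos (by positivity)
  obtain ⟨t, ht, Z, hZ, hγZ⟩ := exists_ge_mem_of_compact
    (isOneParam_oneParam (m := m) (G := G) X).map_add (hopen _ (Metric.ball_mem_nhds 0 hr0))
    (T := 2 / ε) (by positivity)
  have ht0 : 0 < t := lt_of_lt_of_le (by positivity) ht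
  have hZr : ‖Z‖ < r := by simpa using hZ
  have hX := isOneParam_oneParam (m := m) (G := G) X
  have hZ' := isOneParam_oneParam (m := m) (G := G) Z
  have hZδ : ‖Z‖ * (C + 1) < δ := by
    rw [← lt_div_iff₀ (by positivity)]; exact hZr.trans_le (min_le_right _ _)
  dsimp only at hγZ
  -- `Z` is fixed by `Ad (γ s)`, where `γ` is the one-parameter subgroup with velocity `X`
  have hfix : ∀ s, (Ad m (oneParam (m := m) (G := G) X s) Z : Mdl m) = Z := by
    intro s
    set a := oneParam (m := m) (G := G) X s with ha
    have h1 := (hZ'.conj a).unique (isOneParam_oneParam (Ad m a Z))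
    -- Here exp(Z) = exp(tX) commutes with a = exp(sX), so exp(Ad(a) Z) = a exp(Z) a⁻¹ = exp(Z).
    have h2 : oneParam (m := m) (G := G) (Ad m a Z) 1 = oneParam (m := m) (G := G) Z 1 := by
      rw [← h1]
      dsimp only
      rw [hγZ, ha, ← hX.map_neg, ← hX.map_add, ← hX.map_add]
      congr 1
      ring
    refine hinj ?_ ?_ h2
    · have h3 := (A a).le_opNorm Z
      have h4 : ‖A a‖ * ‖Z‖ ≤ C * ‖Z‖ := by gcongr; exact hC a
      refine (mem_ball_zero_iff (E := Mdl m)).2 (lt_of_le_of_lt (h3.trans h4) ?_)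
      nlinarith [norm_nonneg Z]
    · rw [mem_ball_zero_iff]
      nlinarith [norm_nonneg Z]
  have hcomm : ∀ s u, Commute (oneParam (m := m) (G := G) X s) (oneParam (m := m) (G := G) Z u) := by
    intro s u
    have h1 := ((hZ'.conj (oneParam (m := m) (G := G) X s)).congr_velocity (hfix s)).unique hZ'
    have h2 := congrFun h1 u
    exact mul_inv_eq_iff_eq_mul.1 h2
  -- The product is the subgroup of Y = X - Z/t; at time t it equals exp(tX) exp(-Z) = 1. The choice
  -- t ≥ 2/ε gives ‖Z‖/t ≤ ε/2.
  have hY := hX.mul (hZ'.comp_mul (-(1 / t))) fun s u => hcomm s _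
  refine ⟨X + (-(1 / t)) • Z, ?_, t, ht0, ?_⟩
  · rw [add_sub_cancel_left, norm_smul, norm_neg, Real.norm_of_nonneg (by positivity)]
    have h1 : ‖Z‖ ≤ 1 := (hZr.trans_le (min_le_left _ _)).le
    have h2 : 1 / t ≤ ε / 2 := by
      rw [div_le_div_iff₀ ht0 two_pos]
      rw [ge_iff_le, div_le_iff₀ hε] at ht
      linarith
    calc 1 / t * ‖Z‖ ≤ ε / 2 * 1 := by gcongr
      _ < ε := by linarith
  · refine (congrFun ((isOneParam_oneParam _).unique hY) t).trans ?_
    rw [← hγZ, ← hZ'.map_add, neg_mul, one_div, inv_mul_cancel₀ ht0.ne', add_neg_cancel,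
      hZ'.map_zero]

attribute [local instance] finrank_real_complex_fact'

/-- The argument is a local inverse of `Circle.exp`; it is used to transport smoothness from ℝ to
the circle near 1. -/
theorem contMDiffAt_circle_arg :
    ContMDiffAt (𝓡 1) 𝓘(ℝ, ℝ) ∞ (fun z : Circle => Complex.arg z) 1 := by
  have h1 : ContMDiff (𝓡 1) 𝓘(ℝ, ℂ) ∞ (fun z : Circle => (z : ℂ)) :=
    contMDiff_coe_sphere (E := ℂ) (n := 1)
  have h2 : ContDiffAt ℝ ∞ (fun z : ℂ => (Complex.log z).im) 1 :=
    Complex.imCLM.contDiff.contDiffAt.comp (1 : ℂ)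
      ((Complex.contDiffAt_log (n := ∞) Complex.one_mem_slitPlane).restrict_scalars ℝ)
  have h3 := ContMDiffAt.comp_of_eq (x := (1 : Circle)) h2.contMDiffAt h1.contMDiffAt rfl
  exact h3.congr_of_eventuallyEq (Eventually.of_forall fun z => by simp [Complex.log_im])

/-- A nontrivial periodic one-parameter subgroup parametrizes a circle subgroup. -/
theorem exists_circleSubgroup {γ : ℝ → G} {Y : Mdl m} (h : IsOneParam (m := m) γ Y) (hY : Y ≠ 0)
    [T2Space G] {T : ℝ} (hT : 0 < T) (hγT : γ T = 1) :
    ∃ (H : CircleSubgroup m G) (u : LieAlg 1 Circle) (c : ℝ),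
      c ≠ 0 ∧ (lieMap H.incl u : Mdl m) = c • Y := by
  let P : AddSubgroup ℝ :=
    { carrier := {t | γ t = 1}
      add_mem' := fun {s t} hs ht => by
        rw [mem_ofPred_eq] at *; rw [h.map_add, hs, ht, one_mul]
      zero_mem' := h.map_zero
      neg_mem' := fun {t} ht => by
        rw [mem_ofPred_eq] at *; rw [h.map_neg, ht, inv_one] }
  have hPmem : ∀ t, t ∈ P ↔ γ t = 1 := fun t => Iff.rfl
  have hPc : IsClosed (P : Set ℝ) := isClosed_eq h.continuous continuous_const
  -- A closed subgroup of ℝ is everything or cyclic. If every real number were a period, γ would be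
  -- constant and Y = 0.
  obtain ⟨a, ha⟩ : ∃ a : ℝ, P = AddSubgroup.closure {a} := by
    refine P.dense_or_cyclic.resolve_left fun hd => hY ?_
    have h1 : (P : Set ℝ) = univ := by rw [← hPc.closure_eq, hd.closure_eq]
    have h2 : γ = fun _ => 1 := funext fun t => (hPmem t).1 (h1 ▸ mem_univ t : t ∈ (P : Set ℝ))
    have h3 := h.hasMFDerivAt_zero
    subst h2
    have h4 := hasMFDerivAt_unique h3 (hasMFDerivAt_const (I := 𝓘(ℝ, ℝ)) (I' := 𝓡 m) (1 : G) (0 : ℝ))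
    have h5 : (1 : ℝ) • Y = 0 := congrArg (fun L : ℝ →L[ℝ] Mdl m => L 1) h4
    rwa [one_smul] at h5
  have hPiff : ∀ t, γ t = 1 ↔ ∃ k : ℤ, k * a = t := fun t => by
    rw [← hPmem, ha, AddSubgroup.mem_closure_singleton]
    simp
  have ha0 : a ≠ 0 := by
    rintro rfl
    obtain ⟨k, hk⟩ := (hPiff T).1 hγT
    simp at hk
    exact hT.ne hk
  have hπ := Real.pi_pos
  -- This scaling matches the period 2π of the angle with the generator `a` of the periods. The jump
  -- of `arg` is then invisible to `f`, and only z = 1 maps to 1.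
  set c : ℝ := a / (2 * Real.pi) with hc
  have hc0 : c ≠ 0 := by positivity
  set f : Circle → G := fun z => γ (c * Complex.arg z) with hf
  have hexp : ∀ θ : ℝ, f (Circle.exp θ) = γ (c * θ) := by
    intro θ
    obtain ⟨k, hk⟩ := Circle.exp_eq_exp.1 (Circle.exp_arg (Circle.exp θ))
    rw [hf]
    dsimp only
    rw [hk, mul_add, h.map_add, (hPiff (c * (k * (2 * Real.pi)))).2 ⟨k, ?_⟩, mul_one]
    rw [hc]; field_simp
  have hmul : ∀ z w, f (z * w) = f z * f w := by
    intro z w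
    rw [← Circle.exp_arg z, ← Circle.exp_arg w, ← Circle.exp_add, hexp, hexp, hexp, mul_add,
      h.map_add]
  have hone : f 1 = 1 := by
    rw [← Circle.exp_zero, hexp, mul_zero, h.map_zero]
  have hsm1 : ContMDiffAt (𝓡 1) (𝓡 m) ∞ f 1 := by
    have h1 : ContMDiff 𝓘(ℝ, ℝ) (𝓡 m) ∞ (fun t => γ (c * t)) :=
      h.contMDiff.comp (contDiff_const.mul contDiff_id).contMDiff
    exact h1.contMDiffAt.comp (1 : Circle) contMDiffAt_circle_arg
  have hsm : ContMDiff (𝓡 1) (𝓡 m) ∞ f := by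
    intro z
    have h1 : ContMDiffAt (𝓡 1) (𝓡 1) ∞ (fun w : Circle => z⁻¹ * w) z :=
      contMDiffAt_const.mul contMDiffAt_id
    have h2 := ContMDiffAt.comp_of_eq hsm1 h1 (by simp)
    refine (contMDiffAt_const (c := f z) |>.mul h2).congr_of_eventuallyEq
      (Eventually.of_forall fun w => ?_)
    simp [← hmul]
  let F : LieGroupHom 1 m Circle G :=
    { toFun := f, map_one' := hone, map_mul' := hmul, contMDiff_toFun := hsm }
  have hFinj : Function.Injective F := by
    refine (injective_iff_map_eq_one F.toMonoidHom).2 fun z hz => ?_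
    have hz' : γ (c * Complex.arg z) = 1 := hz
    obtain ⟨k, hk⟩ := (hPiff _).1 hz'
    rw [← Circle.exp_arg z, Circle.exp_eq_one]
    refine ⟨k, mul_left_cancel₀ hc0 ?_⟩
    rw [← hk, hc]; field_simp
  have hE : MDifferentiable 𝓘(ℝ, ℝ) (𝓡 1) Circle.exp :=
    (contMDiff_circleExp (m := ∞)).mdifferentiable (by simp)
  -- The tangent vector is the velocity of `Circle.exp` at 0; `F` sends it to the velocity of θ ↦
  -- γ(cθ), namely cY.
  refine ⟨⟨F, hFinj⟩, (mfderiv 𝓘(ℝ, ℝ) (𝓡 1) Circle.exp 0 : ℝ →L[ℝ] Mdl 1) 1, c, hc0, ?_⟩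
  have h1 : HasMFDerivAt (𝓡 1) (𝓡 m) f (Circle.exp 0) (lieMap F : Mdl 1 →L[ℝ] Mdl m) := by
    rw [Circle.exp_zero]
    exact (hsm.mdifferentiable (by simp) (1 : Circle)).hasMFDerivAt
  have h2 := HasMFDerivAt.comp 0 h1 (hE 0).hasMFDerivAt
  rw [show f ∘ Circle.exp = fun θ => γ (c * θ) from funext hexp] at h2
  have h3 := hasMFDerivAt_unique h2 (h.comp_mul c).hasMFDerivAt_zero
  have h4 := congrArg (fun L : ℝ →L[ℝ] Mdl m => L 1) h3
  exact h4.trans (one_smul ℝ (c • Y))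

end CircleDirections

/-! ### Polynomials in coordinates and their homogeneous parts along lines. -/

section PolynomialFunctions

open MvPolynomial

/-- The complex-valued function on `ℝᵐ` defined by a polynomial in the coordinates. -/
noncomputable def evalPoly {m : ℕ} : MvPolynomial (Fin m) ℂ →ₐ[ℂ] (Mdl m → ℂ) :=
  aeval fun i X => ((X i : ℝ) : ℂ)

variable {m : ℕ}

theorem evalPoly_apply (P : MvPolynomial (Fin m) ℂ) (X : Mdl m) :
    evalPoly P X = eval (fun i => ((X i : ℝ) : ℂ)) P := by
  induction P using MvPolynomial.induction_on with
  | C a => simp [evalPoly]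
  | add p q hp hq => simp [hp, hq]
  | mul_X p i hp => simp [hp]; simp [evalPoly]

theorem evalPoly_smul {P : MvPolynomial (Fin m) ℂ} {k : ℕ} (hP : P.IsHomogeneous k) (r : ℝ)
    (X : Mdl m) : evalPoly P (r • X) = (r : ℂ) ^ k * evalPoly P X := by
  rw [evalPoly_apply, evalPoly_apply, eval_eq', eval_eq', Finset.mul_sum]
  refine Finset.sum_congr rfl fun d hd => ?_
  have hk : ∑ i, d i = k := by
    rw [← hP (mem_support_iff.1 hd), Finsupp.weight_apply, Finsupp.sum_fintype _ _ (by simp)]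
    simp
  rw [← hk, ← Finset.prod_pow_eq_pow_sum]
  simp only [PiLp.smul_apply, smul_eq_mul, Complex.ofReal_mul, mul_pow, Finset.prod_mul_distrib]
  ring

theorem continuous_evalPoly (P : MvPolynomial (Fin m) ℂ) : Continuous (evalPoly P) := by
  rw [show evalPoly P = fun X => eval (fun i => ((X i : ℝ) : ℂ)) P from funext (evalPoly_apply P)]
  refine (MvPolynomial.continuous_eval P).comp ?_
  fun_prop

/-- Every linear form is a combination of coordinates. This makes the grading and Noetherianity of
`MvPolynomial` available for `PolyFun`. -/
theorem polyFun_eq_range_evalPoly : PolyFun (Mdl m) = (evalPoly (m := m)).range := by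
  rw [PolyFun, evalPoly, ← Algebra.adjoin_range_eq_range_aeval]
  refine le_antisymm (Algebra.adjoin_le ?_) (Algebra.adjoin_mono ?_)
  · rintro _ ⟨l, rfl⟩
    have e : (fun X : Mdl m => ((l X : ℝ) : ℂ)) =
        ∑ i, ((l (EuclideanSpace.single i 1) : ℝ) : ℂ) • fun X : Mdl m => ((X i : ℝ) : ℂ) := by
      funext X
      have h := (EuclideanSpace.basisFun (Fin m) ℝ).sum_repr X
      conv_lhs => rw [← h]
      simp [mul_comm]
    rw [e]
    exact Subalgebra.sum_mem _ fun i _ => Subalgebra.smul_mem _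
      (Algebra.subset_adjoin (Set.mem_range_self i)) _
  · rintro _ ⟨i, rfl⟩
    exact ⟨(EuclideanSpace.proj i : Mdl m →L[ℝ] ℝ).toLinearMap, rfl⟩

theorem exists_evalPoly_eq {f : Mdl m → ℂ} (hf : f ∈ PolyFun (Mdl m)) : ∃ P, evalPoly P = f := by
  rw [polyFun_eq_range_evalPoly] at hf
  exact hf

theorem evalPoly_mem (P : MvPolynomial (Fin m) ℂ) : evalPoly P ∈ PolyFun (Mdl m) := by
  rw [polyFun_eq_range_evalPoly]
  exact ⟨P, rfl⟩

theorem iteratedDeriv_eval_ofReal (q : Polynomial ℂ) (k : ℕ) :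
    iteratedDeriv k (fun r : ℝ => q.eval (r : ℂ)) =
      fun r : ℝ => (Polynomial.derivative^[k] q).eval (r : ℂ) := by
  induction k with
  | zero => simp
  | succ k ih =>
    rw [iteratedDeriv_succ, ih]
    funext r
    rw [Function.iterate_succ_apply']
    exact ((Polynomial.derivative^[k] q).hasDerivAt (r : ℂ)).comp_ofReal.deriv

section homogPart

variable {G : Type*} [TopologicalSpace G] [ChartedSpace (EuclideanSpace ℝ (Fin m)) G] [Group G]

theorem homogPart_eq_coeff {f : LieAlg m G → ℂ} {X : LieAlg m G} {q : Polynomial ℂ}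
    (h : ∀ r : ℝ, f (r • X) = q.eval (r : ℂ)) (k : ℕ) : homogPart f k X = q.coeff k := by
  rw [homogPart, show (fun r : ℝ => f (r • X)) = fun r : ℝ => q.eval (r : ℂ) from funext h,
    iteratedDeriv_eval_ofReal]
  dsimp only
  rw [Complex.ofReal_zero, ← Polynomial.coeff_zero_eq_eval_zero, Polynomial.coeff_iterate_derivative,
    zero_add, Nat.descFactorial_self, nsmul_eq_mul, mul_div_cancel_left₀]
  exact_mod_cast k.factorial_ne_zero

/-- The restriction of `evalPoly P` to the line through `X`. -/
noncomputable def linePoly (P : MvPolynomial (Fin m) ℂ) (X : Mdl m) : Polynomial ℂ :=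
  ∑ j ∈ Finset.range (P.totalDegree + 1),
    Polynomial.monomial j (evalPoly (homogeneousComponent j P) X)

theorem eval_linePoly (P : MvPolynomial (Fin m) ℂ) (X : Mdl m) (r : ℝ) :
    evalPoly P (r • X) = (linePoly P X).eval (r : ℂ) := by
  conv_lhs => rw [← sum_homogeneousComponent P]
  rw [map_sum, Finset.sum_apply, linePoly, Polynomial.eval_finsetSum]
  refine Finset.sum_congr rfl fun j _ => ?_
  rw [evalPoly_smul (homogeneousComponent_isHomogeneous j P), Polynomial.eval_monomial, mul_comm]

theorem coeff_linePoly (P : MvPolynomial (Fin m) ℂ) (X : Mdl m) (k : ℕ) :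
    (linePoly P X).coeff k = evalPoly (homogeneousComponent k P) X := by
  rw [linePoly, Polynomial.finsetSum_coeff]
  simp only [Polynomial.coeff_monomial]
  rw [Finset.sum_ite_eq']
  split_ifs with h
  · rfl
  · rw [homogeneousComponent_eq_zero _ _ (by simpa using h)]
    simp

theorem homogPart_evalPoly (P : MvPolynomial (Fin m) ℂ) (k : ℕ) (X : Mdl m) :
    homogPart (G := G) (evalPoly P) k X = evalPoly (homogeneousComponent k P) X := by
  rw [← coeff_linePoly]
  exact homogPart_eq_coeff (G := G) (f := evalPoly P) (X := X) (eval_linePoly P X) k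

/-- Elements of `I(G)` vanishing to order `n` on lines through the origin. -/
theorem exists_pow_dvd_of_mem_augIdeal_pow {n : ℕ} {f : InvPoly m G} (hf : f ∈ augIdeal m G ^ n)
    (X : LieAlg m G) :
    ∃ q : Polynomial ℂ, (∀ r : ℝ, f.1 (r • X) = q.eval (r : ℂ)) ∧ Polynomial.X ^ n ∣ q := by
  have hex : ∀ f : InvPoly m G, ∃ q : Polynomial ℂ, ∀ r : ℝ, f.1 (r • X) = q.eval (r : ℂ) := by
    intro f
    obtain ⟨P, hP⟩ := exists_evalPoly_eq (m := m) f.2.1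
    exact ⟨linePoly P X, fun r =>
      (congrFun hP (r • X)).symm.trans (eval_linePoly P X r)⟩
  induction n generalizing f with
  | zero =>
    obtain ⟨q, hq⟩ := hex f
    exact ⟨q, hq, by simp⟩
  | succ n ih =>
    rw [pow_succ] at hf
    induction hf using Submodule.mul_induction_on' with
    | mem_mul_mem a ha b hb =>
      obtain ⟨q, hq, hd⟩ := ih ha
      obtain ⟨p, hp⟩ := hex b
      refine ⟨q * p, fun r => ?_, ?_⟩
      · rw [Polynomial.eval_mul, ← hq, ← hp]; rfl
      · rw [pow_succ]
        refine mul_dvd_mul hd ?_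
        rw [Polynomial.X_dvd_iff, Polynomial.coeff_zero_eq_eval_zero]
        have h0 := hp 0
        rw [Complex.ofReal_zero, zero_smul] at h0
        rw [← h0]
        exact hb
    | add a _ b _ iha ihb =>
      obtain ⟨q, hq, hd⟩ := iha
      obtain ⟨p, hp, hd'⟩ := ihb
      refine ⟨q + p, fun r => ?_, dvd_add hd hd'⟩
      rw [Polynomial.eval_add, ← hq, ← hp]; rfl

/-- The difference restricts to each line as a multiple of the n-th power of the variable, so it has
no part of degree below n. Thus the degree k part of an element of the completion can be read off
modulo the power k + 1. -/
theorem homogPart_congr_of_sub_mem {n k : ℕ} (hk : k < n) {f g : InvPoly m G}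
    (h : f - g ∈ augIdeal m G ^ n) (X : LieAlg m G) :
    homogPart f.1 k X = homogPart g.1 k X := by
  obtain ⟨q, hq, hd⟩ := exists_pow_dvd_of_mem_augIdeal_pow h X
  obtain ⟨P, hP⟩ := exists_evalPoly_eq (m := m) g.2.1
  have hg : ∀ r : ℝ, g.1 (r • X) = (linePoly P X).eval (r : ℂ) := fun r =>
    (congrFun hP (r • X)).symm.trans (eval_linePoly P X r)
  have hf : ∀ r : ℝ, f.1 (r • X) = (q + linePoly P X).eval (r : ℂ) := fun r => by
    rw [Polynomial.eval_add, ← hg, ← hq]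
    change f.1 (r • X) = (f.1 (r • X) - g.1 (r • X)) + g.1 (r • X)
    ring
  rw [homogPart_eq_coeff hf, homogPart_eq_coeff hg, Polynomial.coeff_add,
    Polynomial.X_pow_dvd_iff.1 hd k hk, zero_add]

end homogPart

end PolynomialFunctions

/-! ### Averaging over the group and Hilbert's finiteness argument. -/

section InvariantTheory

open MvPolynomial

/-- Averaging of continuous functions over a compact group. -/
theorem exists_invariantMean (G : Type*) [TopologicalSpace G] [Group G] [IsTopologicalGroup G]
    [CompactSpace G] [T2Space G] :
    ∃ L : C(G, ℂ) →ₗ[ℂ] ℂ, L 1 = 1 ∧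
      ∀ (b : G) (φ : C(G, ℂ)), L (φ.comp (ContinuousMap.mulLeft b)) = L φ := by
  let _ : MeasurableSpace G := borel G
  have : BorelSpace G := ⟨rfl⟩
  let K : TopologicalSpace.PositiveCompacts G := ⊤
  let μ : MeasureTheory.Measure G := MeasureTheory.Measure.haarMeasure K
  have hμ : μ Set.univ = 1 := MeasureTheory.Measure.haarMeasure_self (K₀ := K)
  have : MeasureTheory.IsProbabilityMeasure μ := ⟨hμ⟩
  have hint : ∀ φ : C(G, ℂ), MeasureTheory.Integrable φ μ := fun φ =>
    φ.continuous.integrable_of_hasCompactSupport (HasCompactSupport.of_compactSpace _)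
  refine ⟨{ toFun := fun φ => ∫ a, φ a ∂μ, map_add' := fun φ ψ =>
      MeasureTheory.integral_add (hint φ) (hint ψ), map_smul' := fun c φ =>
      MeasureTheory.integral_smul c φ }, ?_, fun b φ => ?_⟩
  · simp
  · exact MeasureTheory.integral_mul_left_eq_self (μ := μ) (fun a => φ a) b

variable {m : ℕ} {G : Type*} [TopologicalSpace G] [ChartedSpace (EuclideanSpace ℝ (Fin m)) G]
  [Group G] [LieGroup (𝓡 m) ∞ G]

variable (m) in
/-- The adjoint action, as an action on the model space. -/
noncomputable def AdMdl (a : G) : Mdl m →L[ℝ] Mdl m := Ad m a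

theorem AdMdl_mul (a b : G) (X : Mdl m) : AdMdl m (a * b) X = AdMdl m a (AdMdl m b X) :=
  Ad_mul a b X

theorem continuous_AdMdl_apply (X : Mdl m) : Continuous (fun a : G => AdMdl m a X) :=
  (show Continuous (fun a : G => AdMdl m a) from continuous_Ad).clm_apply continuous_const

/-- The function `a ↦ P (Ad a⁻¹ X)`. -/
noncomputable def orbitFun [IsTopologicalGroup G] (P : MvPolynomial (Fin m) ℂ) (X : Mdl m) :
    C(G, ℂ) :=
  ⟨fun a => evalPoly P (AdMdl m a⁻¹ X : Mdl m),
    (continuous_evalPoly P).comp ((continuous_AdMdl_apply X).comp continuous_inv)⟩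

/-- The coordinates of Ad(a) X are linear in X with coefficients continuous in a. Integration over a
then acts only on coefficients, so averages of polynomials are polynomials. -/
theorem exists_separation (P : MvPolynomial (Fin m) ℂ) :
    ∃ (ι : Type) (_ : Fintype ι) (c : ι → C(G, ℂ)) (Q : ι → MvPolynomial (Fin m) ℂ),
      ∀ (a : G) (X : Mdl m), evalPoly P (AdMdl m a X : Mdl m) = ∑ i, c i a * evalPoly (Q i) X := by
  induction P using MvPolynomial.induction_on with
  | C z =>
    refine ⟨Unit, inferInstance, fun _ => 1, fun _ => C z, fun a X => ?_⟩
    simp [evalPoly_apply]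
  | add p q hp hq =>
    obtain ⟨ι, _, c, Q, h⟩ := hp
    obtain ⟨κ, _, d, R, h'⟩ := hq
    refine ⟨ι ⊕ κ, inferInstance, Sum.elim c d, Sum.elim Q R, fun a X => ?_⟩
    rw [map_add, Pi.add_apply, h, h']
    simp
  | mul_X p i hp =>
    obtain ⟨ι, _, c, Q, h⟩ := hp
    refine ⟨ι × Fin m, inferInstance, fun q => c q.1 *
      ⟨fun a => (((AdMdl m a (EuclideanSpace.single q.2 1 : Mdl m) : Mdl m) i : ℝ) : ℂ), by
        have := continuous_AdMdl_apply (G := G) (EuclideanSpace.single q.2 1 : Mdl m)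
        fun_prop⟩, fun q => Q q.1 * X q.2, fun a Y => ?_⟩
    have e : (((AdMdl m a Y : Mdl m) i : ℝ) : ℂ) =
        ∑ j, (((AdMdl m a (EuclideanSpace.single j 1 : Mdl m) : Mdl m) i : ℝ) : ℂ) * ((Y j : ℝ) : ℂ) := by
      have h := (EuclideanSpace.basisFun (Fin m) ℝ).sum_repr Y
      let A := AdMdl m a
      have h2 : A Y = ∑ j, Y j • A (EuclideanSpace.single j 1) := by
        conv_lhs => rw [← h]
        simp
      have h3 := congrArg (fun v : Mdl m => ((v i : ℝ) : ℂ)) h2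
      refine h3.trans ?_
      simp [A, mul_comm]
    have hX : ∀ (j : Fin m) (Z : Mdl m), evalPoly (X j) Z = ((Z j : ℝ) : ℂ) := fun j Z => by
      simp [evalPoly_apply]
    rw [map_mul, Pi.mul_apply, h, hX, e, Finset.sum_mul_sum, Fintype.sum_prod_type]
    refine Finset.sum_congr rfl fun k _ => Finset.sum_congr rfl fun j _ => ?_
    rw [map_mul, Pi.mul_apply, hX]
    simp only [ContinuousMap.mul_apply, ContinuousMap.coe_mk]
    ring

variable (G) in
/-- The polynomial function `evalPoly P` is `Ad(G)`-invariant. -/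
def IsAdInvariant (P : MvPolynomial (Fin m) ℂ) : Prop :=
  ∀ (a : G) (X : Mdl m), evalPoly P (AdMdl m a X : Mdl m) = evalPoly P X

omit [LieGroup (𝓡 m) ∞ G] in
theorem IsAdInvariant.mem {P : MvPolynomial (Fin m) ℂ} (hP : IsAdInvariant G P) :
    (evalPoly P : LieAlg m G → ℂ) ∈ InvPoly m G :=
  ⟨evalPoly_mem P, hP⟩

omit [LieGroup (𝓡 m) ∞ G] in
theorem IsAdInvariant.homogeneousComponent {P : MvPolynomial (Fin m) ℂ} (hP : IsAdInvariant G P)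
    (k : ℕ) : IsAdInvariant G (homogeneousComponent k P) := by
  intro a X
  have h1 := homogPart_evalPoly (G := G) P k X
  have h2 := homogPart_evalPoly (G := G) P k (AdMdl m a X)
  refine (h2.symm.trans ?_).trans h1
  have e : (fun r : ℝ => evalPoly P (r • AdMdl m a X : Mdl m)) = fun r : ℝ => evalPoly P (r • X) := by
    funext r
    rw [← hP a (r • X)]
    exact congrArg (evalPoly P) ((AdMdl m a).map_smul r X).symm
  exact congrArg (fun φ : ℝ → ℂ => iteratedDeriv k φ 0 / (k.factorial : ℂ)) e

/-- The Reynolds operator: every homogeneous `P` has a homogeneous invariant average; averaging is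
linear over the invariants, stated here for a single relation `F = ∑ s p * p`. -/
theorem exists_invariant_coeff [CompactSpace G] [T2Space G] {k : ℕ} {F : MvPolynomial (Fin m) ℂ}
    (hF : IsAdInvariant G F) (t : Finset (MvPolynomial (Fin m) ℂ))
    (ht : ∀ p ∈ t, IsAdInvariant G p) (s : MvPolynomial (Fin m) ℂ → MvPolynomial (Fin m) ℂ)
    (d : MvPolynomial (Fin m) ℂ → ℕ) (hs : ∀ p ∈ t, (s p).IsHomogeneous (k - d p))
    (hsum : F = ∑ p ∈ t, s p * p) :
    ∃ R : MvPolynomial (Fin m) ℂ → MvPolynomial (Fin m) ℂ,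
      (∀ p ∈ t, (R p).IsHomogeneous (k - d p) ∧ IsAdInvariant G (R p)) ∧
      evalPoly F = ∑ p ∈ t, evalPoly (R p) * evalPoly p := by
  have : IsTopologicalGroup G := topologicalGroup_of_lieGroup (𝓡 m) ∞
  obtain ⟨L, hL1, hL⟩ := exists_invariantMean G
  have hpoly : ∀ P : MvPolynomial (Fin m) ℂ, ∃ Q : MvPolynomial (Fin m) ℂ,
      ∀ X, evalPoly Q X = L (orbitFun P X) := by
    intro P
    obtain ⟨ι, _, c, Q, h⟩ := exists_separation (G := G) P
    refine ⟨∑ i, L ((c i).comp ⟨fun a => a⁻¹, continuous_inv⟩) • Q i, fun X => ?_⟩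
    have e : orbitFun P X = ∑ i, (evalPoly (Q i) X) • (c i).comp ⟨fun a => a⁻¹, continuous_inv⟩ := by
      ext a
      simp only [orbitFun, ContinuousMap.coe_mk, h]
      simp [mul_comm]
    rw [e]
    simp [mul_comm]
  choose ρ hρ using hpoly
  have hinv : ∀ P, IsAdInvariant G (ρ P) := by
    intro P b X
    -- Translating a to ba works because (ba)⁻¹ b = a⁻¹.
    rw [hρ, hρ, ← hL b (orbitFun P (AdMdl m b X : Mdl m))]
    congr 1
    ext a
    change evalPoly P (AdMdl m (b * a)⁻¹ (AdMdl m b X) : Mdl m) = evalPoly P (AdMdl m a⁻¹ X : Mdl m)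
    rw [← AdMdl_mul]
    simp
  -- The average scales homogeneously as a function. Passing to the component of degree `e` gives a
  -- homogeneous polynomial with the same values, so injectivity of `evalPoly` is not needed.
  have hhom : ∀ {P : MvPolynomial (Fin m) ℂ} {e : ℕ}, P.IsHomogeneous e →
      evalPoly (homogeneousComponent e (ρ P)) = evalPoly (ρ P) := by
    intro P e hP
    funext X
    rw [← coeff_linePoly]
    have h1 : ∀ r : ℝ, evalPoly (ρ P) (r • X) = (r : ℂ) ^ e * evalPoly (ρ P) X := by
      intro r
      rw [hρ, hρ, ← smul_eq_mul, ← map_smul]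
      congr 1
      ext a
      change evalPoly P (AdMdl m a⁻¹ (r • X) : Mdl m) = (r : ℂ) ^ e * evalPoly P (AdMdl m a⁻¹ X : Mdl m)
      rw [← evalPoly_smul hP]
      exact congrArg (evalPoly P) ((AdMdl m a⁻¹).map_smul r X)
    have h2 := homogPart_eq_coeff (G := G) (f := evalPoly (ρ P)) (X := X) (eval_linePoly (ρ P) X) e
    have h3 := homogPart_eq_coeff (G := G) (f := evalPoly (ρ P)) (X := X)
      (q := Polynomial.monomial e (evalPoly (ρ P) X))
      (fun r => by rw [Polynomial.eval_monomial, mul_comm]; exact h1 r) e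
    rw [← h2, h3, Polynomial.coeff_monomial_same]
  refine ⟨fun p => homogeneousComponent (k - d p) (ρ (s p)), fun p hp =>
    ⟨homogeneousComponent_isHomogeneous _ _, (hinv _).homogeneousComponent _⟩, ?_⟩
  have hfix : evalPoly F = fun X => L (orbitFun F X) := by
    funext X
    have e : orbitFun F X = (evalPoly F X) • (1 : C(G, ℂ)) := by
      ext a
      change evalPoly F (AdMdl m a⁻¹ X : Mdl m) = evalPoly F X * 1
      rw [hF, mul_one]
    rw [e, map_smul, hL1, smul_eq_mul, mul_one]
  rw [hfix]
  funext X
  rw [Finset.sum_apply]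
  -- The factors `p` are invariant, so they come out of the average and only the coefficients `s p`
  -- are averaged.
  have e : orbitFun F X = ∑ p ∈ t, (evalPoly p X) • orbitFun (G := G) (s p) X := by
    ext a
    rw [ContinuousMap.coe_sum, Finset.sum_apply]
    change evalPoly F (AdMdl m a⁻¹ X : Mdl m) =
      ∑ p ∈ t, evalPoly p X * evalPoly (s p) (AdMdl m a⁻¹ X : Mdl m)
    rw [hsum, map_sum, Finset.sum_apply]
    refine Finset.sum_congr rfl fun p hp => ?_
    rw [map_mul, Pi.mul_apply, ht p hp, mul_comm]
  rw [e, map_sum]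
  refine Finset.sum_congr rfl fun p hp => ?_
  rw [Pi.mul_apply, hhom (hs p hp), hρ, map_smul, smul_eq_mul, mul_comm]

theorem homogeneousComponent_mul_of_isHomogeneous {σ : Type*} (a b : MvPolynomial σ ℂ) {k i : ℕ}
    (hb : b.IsHomogeneous i) (h : i ≤ k) :
    homogeneousComponent k (a * b) = homogeneousComponent (k - i) a * b := by
  let _ : GradedAlgebra (homogeneousSubmodule σ ℂ) := MvPolynomial.gradedAlgebra
  have h1 := DirectSum.coe_decompose_mul_of_right_mem_of_le (𝒜 := homogeneousSubmodule σ ℂ)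
    (a := a) (b := b) (n := k) hb h
  have h2 : ∀ (x : MvPolynomial σ ℂ) (j : ℕ),
      (DirectSum.decompose (homogeneousSubmodule σ ℂ) x j : MvPolynomial σ ℂ) =
        homogeneousComponent j x := fun x j => decomposition.decompose'_apply x j
  rwa [h2, h2] at h1

variable (m G) in
/-- Homogeneous invariant polynomials of large degree lie in a given power of `I(G)¹`
(a consequence of Hilbert's finiteness theorem). -/
theorem exists_homogeneous_mem_pow [CompactSpace G] [T2Space G] (n : ℕ) :
    ∃ N : ℕ, ∀ k ≥ N, ∀ (P : MvPolynomial (Fin m) ℂ) (hP : IsAdInvariant G P), P.IsHomogeneous k →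
      (⟨evalPoly P, hP.mem⟩ : InvPoly m G) ∈ augIdeal m G ^ n := by
  let 𝒮 : Set (MvPolynomial (Fin m) ℂ) := {P | IsAdInvariant G P ∧ ∃ d > 0, P.IsHomogeneous d}
  -- By the Hilbert basis theorem, finitely many homogeneous invariants of positive degree generate
  -- the ideal spanned by all of them.
  obtain ⟨t, htS, hspan⟩ :=
    (Submodule.fg_span_iff_fg_span_finset_subset 𝒮).1 (IsNoetherian.noetherian (Ideal.span 𝒮))
  have hdeg : ∀ p : MvPolynomial (Fin m) ℂ, ∃ d : ℕ, p ∈ t → 0 < d ∧ p.IsHomogeneous d := by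
    intro p
    by_cases hp : p ∈ t
    · obtain ⟨-, d, hd, hd'⟩ := htS hp
      exact ⟨d, fun _ => ⟨hd, hd'⟩⟩
    · exact ⟨0, fun h => absurd h hp⟩
  choose d hd using hdeg
  set D : ℕ := t.sup d with hD
  have hdD : ∀ p ∈ t, d p ≤ D := fun p hp => Finset.le_sup hp
  -- Splitting off one generator costs at most D degrees and gains one factor in the augmentation
  -- ideal; the extra 1 keeps the degree positive, so that P lies in 𝒮.
  refine ⟨n * D + 1, ?_⟩
  induction n with
  | zero => intro k _ P hP _; simp
  | succ n ih =>
    intro k hk P hP hPk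
    have hPS : P ∈ Ideal.span 𝒮 := Ideal.subset_span ⟨hP, k, by omega, hPk⟩
    have hPt : P ∈ Submodule.span (MvPolynomial (Fin m) ℂ) (t : Set (MvPolynomial (Fin m) ℂ)) := by
      rw [← hspan]; exact hPS
    obtain ⟨s, -, hs⟩ := Submodule.mem_span_finset.1 hPt
    have hk' : (n + 1) * D = n * D + D := by ring
    have hsum : P = ∑ p ∈ t, homogeneousComponent (k - d p) (s p) * p := by
      rw [← homogeneousComponent_eq_self hPk, ← hs, map_sum]
      refine Finset.sum_congr rfl fun p hp => ?_
      rw [smul_eq_mul, homogeneousComponent_mul_of_isHomogeneous _ _ (hd p hp).2]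
      have := hdD p hp
      omega
    obtain ⟨R, hR, hRsum⟩ := exists_invariant_coeff hP t (fun p hp => (htS hp).1)
      (fun p => homogeneousComponent (k - d p) (s p)) d
      (fun p hp => homogeneousComponent_isHomogeneous _ _) hsum
    have e : (⟨evalPoly P, hP.mem⟩ : InvPoly m G) = ∑ p ∈ t.attach,
        (⟨evalPoly (R p), (hR p p.2).2.mem⟩ : InvPoly m G) * ⟨evalPoly p, (htS p.2).1.mem⟩ := by
      apply Subtype.ext
      rw [← Finset.sum_attach] at hRsum
      refine Eq.trans hRsum ?_
      exact (map_sum (InvPoly m G).val (fun p : t =>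
        (⟨evalPoly (R p), (hR p p.2).2.mem⟩ : InvPoly m G) * ⟨evalPoly p, (htS p.2).1.mem⟩)
          t.attach).symm
    rw [e, pow_succ]
    refine Ideal.sum_mem _ fun p _ => Ideal.mul_mem_mul ?_ ?_
    · refine ih (k - d p) ?_ (R p) (hR p p.2).2 (hR p p.2).1
      have := hdD p p.2
      omega
    · change evalPoly (p : MvPolynomial (Fin m) ℂ) (0 : Mdl m) = 0
      have := evalPoly_smul (hd p p.2).2 0 (0 : Mdl m)
      rwa [zero_smul, Complex.ofReal_zero, zero_pow (hd p p.2).1.ne', zero_mul] at this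

end InvariantTheory

/-! ### Injectivity of restriction to circles. -/

section Restriction

open MvPolynomial

theorem evalₐ_eq_mk_of_le {R : Type*} [CommRing R] {I : Ideal R} {a b : ℕ} (hab : a ≤ b)
    {x : AdicCompletion I R} {f : R}
    (h : AdicCompletion.evalₐ I b x = Ideal.Quotient.mk (I ^ b) f) :
    AdicCompletion.evalₐ I a x = Ideal.Quotient.mk (I ^ a) f := by
  induction x using AdicCompletion.induction_on with | h s => ?_
  rw [AdicCompletion.evalₐ_mk] at h ⊢
  rw [← AdicCompletion.Ideal.mk_eq_mk _ hab s]
  exact Ideal.Quotient.eq.2 (Ideal.pow_le_pow_right hab (Ideal.Quotient.eq.1 h))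

variable {l m : ℕ} {H G : Type*}
  [TopologicalSpace H] [ChartedSpace (EuclideanSpace ℝ (Fin l)) H] [Group H] [LieGroup (𝓡 l) ∞ H]
  [TopologicalSpace G] [ChartedSpace (EuclideanSpace ℝ (Fin m)) G] [Group G] [LieGroup (𝓡 m) ∞ G]

theorem homogPart_invPolyMap (f : LieGroupHom l m H G) (p : InvPoly m G) (k : ℕ)
    (X : LieAlg l H) :
    homogPart (invPolyMap f p).1 k X = homogPart p.1 k (lieMap f X) := by
  unfold homogPart
  have e : (fun r : ℝ => (invPolyMap f p).1 (r • X)) = fun r : ℝ => p.1 (r • lieMap f X) := by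
    funext r
    exact congrArg p.1 ((lieMap f).map_smul r X)
  rw [e]

omit [LieGroup (𝓡 m) ∞ G] in
theorem homogPart_algebraMap (c : ℂ) {k : ℕ} (hk : 1 ≤ k) (X : LieAlg m G) :
    homogPart (algebraMap ℂ (InvPoly m G) c).1 k X = 0 := by
  rw [homogPart_eq_coeff (q := Polynomial.C c) (fun r => by rw [Polynomial.eval_C]; rfl),
    Polynomial.coeff_C_of_ne_zero (by omega)]

variable (G) in
/-- The tangent lines of circle subgroups are dense in the Lie algebra. -/
theorem evalPoly_eq_zero_of_forall_circle [T2Space G] [CompactSpace G]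
    {P : MvPolynomial (Fin m) ℂ} {k : ℕ} (hk : 1 ≤ k) (hP : P.IsHomogeneous k)
    (h : ∀ (H : CircleSubgroup m G) (u : LieAlg 1 Circle), evalPoly P (lieMap H.incl u : Mdl m) = 0)
    (X : Mdl m) : evalPoly P X = 0 := by
  have hzero : evalPoly P (0 : Mdl m) = 0 := by
    have := evalPoly_smul hP 0 (0 : Mdl m)
    rwa [zero_smul, Complex.ofReal_zero, zero_pow (by omega), zero_mul] at this
  have hcl : IsClosed {X : Mdl m | evalPoly P X = 0} :=
    isClosed_eq (continuous_evalPoly P) continuous_const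
  have hmem : X ∈ closure {X : Mdl m | evalPoly P X = 0} := by
    rw [Metric.mem_closure_iff]
    intro ε hε
    obtain ⟨Y, hY, T, hT, hYT⟩ := exists_periodic_near (G := G) X hε
    refine ⟨Y, ?_, by rw [dist_comm, dist_eq_norm]; exact hY⟩
    change evalPoly P Y = 0
    -- The zero velocity yields no circle; there the polynomial vanishes since its degree is
    -- positive.
    by_cases hY0 : Y = 0
    · rw [hY0, hzero]
    obtain ⟨H, u, c, hc, hu⟩ := exists_circleSubgroup (isOneParam_oneParam (G := G) Y) hY0 hT hYT
    have h1 := h H u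
    rw [hu, evalPoly_smul hP] at h1
    exact (mul_eq_zero.1 h1).resolve_left (pow_ne_zero _ (Complex.ofReal_ne_zero.2 hc))
  exact hcl.closure_subset hmem

omit [LieGroup (𝓡 m) ∞ G] in
/-- An invariant polynomial without parts of small positive degree is a constant modulo a given
power of `I(G)¹`. -/
theorem sub_algebraMap_mem_pow {n N : ℕ}
    (hN : ∀ k ≥ N, ∀ (P : MvPolynomial (Fin m) ℂ) (hP : IsAdInvariant G P), P.IsHomogeneous k →
      (⟨evalPoly P, hP.mem⟩ : InvPoly m G) ∈ augIdeal m G ^ n)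
    {f : InvPoly m G} (hf : ∀ k, 1 ≤ k → k < N → ∀ X : LieAlg m G, homogPart f.1 k X = 0) :
    f - algebraMap ℂ (InvPoly m G) (f.1 0) ∈ augIdeal m G ^ n := by
  obtain ⟨P, hP⟩ := exists_evalPoly_eq (m := m) f.2.1
  have hinv : IsAdInvariant G P := fun a X => by
    rw [hP]; exact f.2.2 a X
  have hsum : f = ∑ k ∈ Finset.range (P.totalDegree + 1),
      (⟨evalPoly (homogeneousComponent k P), (hinv.homogeneousComponent k).mem⟩ : InvPoly m G) := by
    apply Subtype.ext
    have h1 : f.1 = ∑ k ∈ Finset.range (P.totalDegree + 1),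
        evalPoly (homogeneousComponent k P) := by
      rw [← map_sum, sum_homogeneousComponent]; exact hP.symm
    refine h1.trans ?_
    exact (map_sum (InvPoly m G).val (fun k : ℕ =>
      (⟨evalPoly (homogeneousComponent k P), (hinv.homogeneousComponent k).mem⟩ : InvPoly m G))
        _).symm
  have h0 : (⟨evalPoly (homogeneousComponent 0 P), (hinv.homogeneousComponent 0).mem⟩ :
      InvPoly m G) = algebraMap ℂ (InvPoly m G) (f.1 0) := by
    apply Subtype.ext
    funext X
    have h1 : evalPoly P (0 : Mdl m) = f.1 0 := congrFun hP 0
    have h2 : f.1 0 = coeff 0 P := by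
      rw [← h1, evalPoly_apply]
      simp [eval_zero', constantCoeff_eq]
    have h3 : ∀ Z : Mdl m, evalPoly (homogeneousComponent 0 P) Z = coeff 0 P := fun Z => by
      rw [homogeneousComponent_zero, evalPoly_apply, eval_C]
    exact (h3 X).trans h2.symm
  rw [Finset.sum_range_succ', h0] at hsum
  rw [sub_eq_iff_eq_add.2 hsum]
  refine Ideal.sum_mem _ fun k _ => ?_
  -- Parts of degree below `N` vanish by hypothesis; those of degree at least `N` lie in the power
  -- by `hN`.
  rcases lt_or_ge (k + 1) N with hk | hk
  · have hz : (⟨evalPoly (homogeneousComponent (k + 1) P), (hinv.homogeneousComponent _).mem⟩ :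
        InvPoly m G) = 0 := by
      apply Subtype.ext
      funext X
      have h1 := hf (k + 1) (by omega) hk X
      have h2 := homogPart_evalPoly (G := G) P (k + 1) X
      exact h2.symm.trans ((congrArg (fun φ : LieAlg m G → ℂ => homogPart φ (k + 1) X) hP).trans h1)
    rw [hz]
    exact Ideal.zero_mem _
  · exact hN _ hk _ (hinv.homogeneousComponent _) (homogeneousComponent_isHomogeneous _ _)

/-- The constant is read off modulo the augmentation ideal itself, so the same one serves for every
n. For each n, a representative modulo a sufficiently high power has no part of small positive
degree, by density of circle directions, and its parts of large degree lie in the n-th power. -/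
theorem mem_span_one_of_completedMap [T2Space G] [CompactSpace G] (x : CompletedInv m G)
    (hx : ∀ H : CircleSubgroup m G,
      completedMap H.incl x ∈ Submodule.span ℂ {(1 : CompletedInv 1 Circle)}) :
    x ∈ Submodule.span ℂ {(1 : CompletedInv m G)} := by
  obtain ⟨f₁, hf₁⟩ := Ideal.Quotient.mk_surjective (AdicCompletion.evalₐ (augIdeal m G) 1 x)
  rw [Submodule.mem_span_singleton]
  refine ⟨f₁.1 0, AdicCompletion.ext_evalₐ fun n => ?_⟩
  obtain ⟨N₀, hN₀⟩ := exists_homogeneous_mem_pow m G n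
  -- `N₀` is for the finiteness bound, `n` for passing down to the n-th power, and 1 for comparing
  -- the value at 0 with that of `f₁`.
  let N := max (max N₀ n) 1
  have hNN₀ : N₀ ≤ N := (le_max_left _ _).trans (le_max_left _ _)
  have hNn : n ≤ N := (le_max_right _ _).trans (le_max_left _ _)
  have hN1 : 1 ≤ N := le_max_right _ _
  obtain ⟨f, hf⟩ := Ideal.Quotient.mk_surjective (AdicCompletion.evalₐ (augIdeal m G) N x)
  have hf0 : f.1 0 = f₁.1 0 := by
    have h1 := (evalₐ_eq_mk_of_le hN1 hf.symm).symm.trans hf₁.symm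
    have h2 := Ideal.Quotient.eq.1 h1
    rw [pow_one] at h2
    exact sub_eq_zero.1 h2
  have hpart : ∀ k, 1 ≤ k → k < N → ∀ X : LieAlg m G, homogPart f.1 k X = 0 := by
    intro k hk hkN X
    obtain ⟨P, hP⟩ := exists_evalPoly_eq (m := m) f.2.1
    have hfP : ∀ Z : LieAlg m G, homogPart f.1 k Z = evalPoly (homogeneousComponent k P) Z :=
      fun Z => (congrArg (fun φ : LieAlg m G → ℂ => homogPart φ k Z) hP).symm.trans
        (homogPart_evalPoly (G := G) P k Z)
    refine (hfP X).trans (evalPoly_eq_zero_of_forall_circle G hk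
      (homogeneousComponent_isHomogeneous k P) (fun H u => ?_) X)
    refine (hfP _).symm.trans ?_
    rw [← homogPart_invPolyMap]
    obtain ⟨c, hc⟩ := Submodule.mem_span_singleton.1 (hx H)
    have h1 := completedMap_eval H.incl N x f hf.symm
    have h2 : AdicCompletion.evalₐ (augIdeal 1 Circle) N (completedMap H.incl x) =
        Ideal.Quotient.mk _ (algebraMap ℂ (InvPoly 1 Circle) c) := by
      rw [← hc, ← Algebra.algebraMap_eq_smul_one]
      exact (((AdicCompletion.evalₐ (augIdeal 1 Circle) N).restrictScalars ℂ).commutes c)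
    rw [homogPart_congr_of_sub_mem hkN (Ideal.Quotient.eq.1 (h1.symm.trans h2)),
      homogPart_algebraMap c hk]
  have h3 := sub_algebraMap_mem_pow (fun k hk => hN₀ k (hNN₀.trans hk)) hpart
  rw [hf0] at h3
  rw [evalₐ_eq_mk_of_le hNn hf.symm, Ideal.Quotient.eq.2 h3, ← Algebra.algebraMap_eq_smul_one]
  exact (((AdicCompletion.evalₐ (augIdeal m G) n).restrictScalars ℂ).commutes (f₁.1 0))

variable (m G) in
theorem circleRestriction_injective [T2Space G] [CompactSpace G] :
    Function.Injective (circleRestriction m G) := by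
  rw [← LinearMap.ker_eq_bot, LinearMap.ker_eq_bot']
  intro τ hτ
  obtain ⟨x, rfl⟩ := Submodule.Quotient.mk_surjective _ τ
  refine (Submodule.Quotient.mk_eq_zero _).2 (mem_span_one_of_completedMap x fun H => ?_)
  exact (Submodule.Quotient.mk_eq_zero _).1 (congrFun (congrArg Subtype.val hτ) H)

/-! ### Compatibility of torsion with restriction. -/

variable {n : ℕ} {M : Type*} [TopologicalSpace M] [ChartedSpace (EuclideanSpace ℝ (Fin n)) M]

omit [LieGroup (𝓡 l) ∞ H] [LieGroup (𝓡 m) ∞ G] in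
theorem SmoothAction.fundamental_pullback (ρ : SmoothAction m n G M) (f : LieGroupHom l m H G)
    (X : LieAlg l H) : (ρ.pullback f).fundamental X = ρ.fundamental (lieMap f X) := by
  funext x
  have hf : MDifferentiable (𝓡 l) (𝓡 m) f := f.contMDiff_toFun.mdifferentiable (by simp)
  have hρ : ContMDiff (𝓡 m) (𝓡 n) ∞ (fun a : G => ρ.act a x) :=
    ρ.smooth.comp (contMDiff_id.prodMk contMDiff_const)
  have h1 := mfderiv_comp (I := 𝓡 l) (I' := 𝓡 m) (I'' := 𝓡 n) (1 : H)
    (g := fun a : G => ρ.act a x) (f := f) (hρ.mdifferentiable (by simp) _) (hf _)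
  rw [map_one f] at h1
  exact congrArg (fun L : EuclideanSpace ℝ (Fin l) →L[ℝ] EuclideanSpace ℝ (Fin n) => L X) h1

/-- The restriction of the torsion to a subgroup is the torsion of the restricted action. -/
theorem IsTorsion.pullback [IsManifold (𝓡 n) ∞ M] {ρ : SmoothAction m n G M}
    {g : SmoothMetric n M} {τ : ReducedInv m G} (h : IsTorsion ρ g τ) (f : LieGroupHom l m H G) :
    IsTorsion (ρ.pullback f) g (reducedMap f τ) := by
  obtain ⟨x, rfl, hx⟩ := h
  refine ⟨completedMap f x, rfl, fun k hk q hq X => ?_⟩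
  obtain ⟨p, hp⟩ := Ideal.Quotient.mk_surjective (AdicCompletion.evalₐ (augIdeal m G) (k + 1) x)
  have h1 := completedMap_eval f (k + 1) x p hp.symm
  -- The given representative `q` and the pullback of `p` agree modulo the power k + 1, hence in
  -- degree k; this transfers the condition from f_* X to X.
  rw [homogPart_congr_of_sub_mem k.lt_succ_self (Ideal.Quotient.eq.1 (hq.symm.trans h1)),
    homogPart_invPolyMap, SmoothAction.fundamental_pullback]
  exact hx k hk p hp.symm (lieMap f X)

end Restriction

/-- `R_G : Ĩ(G) → lim_{S(G)} Ĩ_G` is injective, and the torsion `T(M)` (with respect to any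
`G`-invariant metric) is determined by the torsions `T(res^G_H M)` of its restrictions to the
circle subgroups `H`. -/
theorem lemma5p2 {m : ℕ} (G : Type*) [TopologicalSpace G]
    [ChartedSpace (EuclideanSpace ℝ (Fin m)) G] [Group G] [LieGroup (𝓡 m) ∞ G]
    [T2Space G] [CompactSpace G] [ConnectedSpace G] :
    Function.Injective (circleRestriction m G) ∧
    ∀ {n n' : ℕ} (M M' : Type*)
      [TopologicalSpace M] [ChartedSpace (EuclideanSpace ℝ (Fin n)) M] [IsManifold (𝓡 n) ∞ M]
      [T2Space M] [CompactSpace M]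
      [TopologicalSpace M'] [ChartedSpace (EuclideanSpace ℝ (Fin n')) M']
      [IsManifold (𝓡 n') ∞ M'] [T2Space M'] [CompactSpace M']
      (ρ : SmoothAction m n G M) (ρ' : SmoothAction m n' G M')
      (g : SmoothMetric n M) (g' : SmoothMetric n' M'),
      ρ.IsInvariantMetric g → ρ'.IsInvariantMetric g' →
      ∀ τ τ' : ReducedInv m G, IsTorsion ρ g τ → IsTorsion ρ' g' τ' →
        (∀ (H : CircleSubgroup m G) (σ σ' : ReducedInv 1 Circle),
          IsTorsion (ρ.pullback H.incl) g σ → IsTorsion (ρ'.pullback H.incl) g' σ' → σ = σ') →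
        τ = τ' := by
  refine ⟨circleRestriction_injective m G, ?_⟩
  intro n n' M M' _ _ _ _ _ _ _ _ _ _ ρ ρ' g g' _ _ τ τ' hτ hτ' h
  refine circleRestriction_injective m G (Subtype.ext (funext fun H => ?_))
  -- The restrictions of τ and τ' are themselves torsions of the restricted actions, so the
  -- hypothesis applies to them and no separate existence statement is required.
  exact h H _ _ (hτ.pullback H.incl) (hτ'.pullback H.incl)
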